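/- **Setting.** Consider the 1D Euler equations with gravity for an ideal gas with constant $\gamma>1$. States are $\mathbf U=(\rho,m,E)^\top$, with $u=m/\rho$, $e=\frac1\rho\big(E-\frac{m^2}{2\rho}\big)$, $p=(\gamma-1)\rho e$, flux $\mathbf F(\mathbf U)=(\rho u,\ \rho u^2+p,\ (E+p)u)^\top$, $\alpha_{\max}(\mathbf U)=|u|+\sqrt{\gamma p/\rho}$, and admissible set $$G=\Big\{\mathbf U:\ \rho>0,\ E-\tfrac{m^2}{2\rho}>0\Big\}.$$ Let $\mathbf F^{hllc}(\mathbf U_L,\mathbf U_R)$ be the HLLC flux: it equals $\mathbf F(\mathbf U_L)$ if $0\le S_L$, $\mathbf F_{*L}$ if $S_L\le 0\le S_*$, $\mathbf F_{*R}$ if $S_*\le 0\le S_R$, and $\mathbf F(\mathbf U_R)$ if $0\ge S_R$, where $S_L=\min_{i=L,R}\big(u_i-\sqrt{\gamma p_i/\rho_i}\big)$, $S_R=\max_{i=L,R}\big(u_i+\sqrt{\gamma p_i/\rho_i}\big)$, $$S_*=\frac{p_R-p_L+\rho_Lu_L(S_L-u_L)-\rho_Ru_R(S_R-u_R)}{\rho_L(S_L-u_L)-\rho_R(S_R-u_R)},\qquad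 \mathbf F_{*i}=\mathbf F(\mathbf U_i)+S_i(\mathbf U_{*i}-\mathbf U_i),$$ $$\mathbf U_{*i}=\rho_i\frac{S_i-u_i}{S_i-S_*}\Big(1,\ S_*,\ \frac{E_i}{\rho_i}+(S_*-u_i)\Big(S_*+\frac{p_i}{\rho_i(S_i-u_i)}\Big)\Big)^\top .$$ **Mesh and quadrature.** The domain $\Omega$ is divided into cells $I_j=(x_{j-1/2},x_{j+1/2})$, $j\in J\subset\mathbb Z$, of length $h_j>0$. $\mathbb V_h^k$ is the space of functions on $\Omega$ that are polynomials of degree $\le k$ on each cell; $\overline{(\cdot)}_j$ denotes the average over $I_j$, and $x_{j+1/2}^\mp$ the limits from the left and from the right. In each $I_j$ let $x_j^{(\mu)},\omega_\mu$ ($1\le\mu\le N$) be the points and the weights (with sum $1$) of the $N$-point Gauss rule, with $2N-1\ge k$, and let $\widehat x_j^{(\nu)}$ ($1\le\nu\le L$) be the points of the $L$-point Gauss–Lobatto rule, with $L\ge (k+3)/2$, whose normalised endpoint weight is $\widehat\omega_1=\frac1{L(L-1)}$. Let $\mathbb S_j$ be the set of all these Gauss and Gauss–Lobatto points of $I_j$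 (the values at the two endpoints being the limits from inside $I_j$). **Scheme.** Let $\rho_h^e,p_h^e\in\mathbb V_h^k$ (the projected equilibrium density and pressure) and $\mathbf U_h=(\rho_h,m_h,E_h)^\top\in[\mathbb V_h^k]^3$, $\mathbf U^\pm_{j+1/2}=\mathbf U_h(x^\pm_{j+1/2})$. At a boundary point of $\Omega$ (if there is one) the exterior limits of $\mathbf U_h$ and $p_h^e$ are given by boundary data. Put $p^{e,\star}_{j+1/2}=\frac12\big(p_h^e(x_{j+1/2}^-)+p_h^e(x_{j+1/2}^+)\big)$, $[\![p_h^e]\!]_{j+1/2}=p_h^e(x_{j+1/2}^+)-p_h^e(x_{j+1/2}^-)$, and $$\widehat{\mathbf F}_{j+\frac12}=\mathbf F^{hllc}\Big(\frac{p^{e,\star}_{j+1/2}}{p_h^e(x_{j+1/2}^-)}\mathbf U_{j+\frac12}^-,\ \frac{p^{e,\star}_{j+1/2}}{p_h^e(x_{j+1/2}^+)}\mathbf U_{j+\frac12}^+\Big).$$ For a polynomial $v$ and $(\ell,q)\in\{(2,\rho_h),(3,m_h)\}$ put $$\begin{aligned}\langle S^{[\ell]},v\rangle_j={}&h_j\sum_{\mu=1}^N\omega_\mu\Big(\frac{q(x_j^{(\mu)})}{\rho_h^e(x_j^{(\mu)})}-\frac{\overline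 q_j}{\overline{(\rho_h^e)}_j}\Big)(p_h^e)_x(x_j^{(\mu)})\,v(x_j^{(\mu)})\\&+\frac{\overline q_j}{\overline{(\rho_h^e)}_j}\Big(p^{e,\star}_{j+\frac12}v(x_{j+\frac12}^-)-p^{e,\star}_{j-\frac12}v(x_{j-\frac12}^+)-h_j\sum_{\mu=1}^N\omega_\mu\,p_h^e(x_j^{(\mu)})\,v_x(x_j^{(\mu)})\Big).\end{aligned}$$ The well-balanced DG scheme of degree $k$ is: for all $j\in J$ and all polynomials $v$ of degree $\le k$, $$\int_{I_j}(\mathbf U_h)_t\,v\,dx=h_j\sum_{\mu=1}^N\omega_\mu\mathbf F\big(\mathbf U_h(x_j^{(\mu)})\big)v_x(x_j^{(\mu)})-\Big(\widehat{\mathbf F}_{j+\frac12}v(x_{j+\frac12}^-)-\widehat{\mathbf F}_{j-\frac12}v(x_{j-\frac12}^+)\Big)+\big(0,\langle S^{[2]},v\rangle_j,\langle S^{[3]},v\rangle_j\big)^\top .$$ With $v=1$ the cell averages $\overline{\mathbf U}_j$ of $\mathbf U_h$ evolve by $$\frac{d\overline{\mathbf U}_j}{dt}=\mathbf L_j(\mathbf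 U_h):=-\frac1{h_j}\big(\widehat{\mathbf F}_{j+\frac12}-\widehat{\mathbf F}_{j-\frac12}\big)+\frac1{h_j}\big(0,\langle S^{[2]},1\rangle_j,\langle S^{[3]},1\rangle_j\big)^\top.$$ **CFL number.** With $e_h$ and $\overline e_j$ the specific internal energies of $\mathbf U_h$ and of $\overline{\mathbf U}_j$, let $\widetilde\alpha_j=\widetilde\alpha_j^F+\widetilde\alpha_j^S+\overline\alpha_j^S$ with $$\widetilde\alpha_j^F=2\max\Big\{\frac{p^{e,\star}_{j+1/2}}{p_h^e(x^-_{j+1/2})},\frac{p^{e,\star}_{j-1/2}}{p_h^e(x^+_{j-1/2})}\Big\}\max_{\mathbf U\in\{\mathbf U^\pm_{j-1/2},\mathbf U^\pm_{j+1/2}\}}\alpha_{\max}(\mathbf U),$$ $$\widetilde\alpha_j^S=\widehat\omega_1h_j\max_{1\le\mu\le N}\frac{|(p_h^e)_x(x_j^{(\mu)})|}{\rho_h^e(x_j^{(\mu)})\sqrt{2e_h(x_j^{(\mu)})}},\qquad \overline\alpha_j^S=\widehat\omega_1\frac{\big|[\![p_h^e]\!]_{j+1/2}+[\![p_h^e]\!]_{j-1/2}\big|}{2\,\overline{(\rho_h^e)}_j\sqrt{2\overline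 e_j}}.$$ **Theorem.** Assume that $\rho_h^e(x)>0$, $p_h^e(x)>0$ and $\mathbf U_h(x)\in G$ for all $x\in\mathbb S_j$ and all $j\in J$, and that at boundary points of $\Omega$ the exterior limits of $p_h^e$ are positive and those of $\mathbf U_h$ lie in $G$. If $\Delta t>0$ satisfies $$\widetilde\alpha_j\,\Delta t\le\widehat\omega_1h_j\qquad\text{for all } j\in J,$$ then $$\overline{\mathbf U}_j+\Delta t\,\mathbf L_j(\mathbf U_h)\in G\qquad\text{for all } j\in J.$$ In particular, if $\mathbf U_h^{new}\in[\mathbb V_h^k]^3$ results from $\mathbf U_h$ by one forward-Euler step of size $\Delta t$ of the DG scheme, then all its cell averages lie in $G$. -/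

import Mathlib

open Polynomial

namespace WBDG

noncomputable section

/-! ## One-dimensional Euler equations with the ideal-gas law -/

/-- A vector of conservative variables `(ρ, m, E)` (density, momentum, total energy). -/
abbrev State : Type := Fin 3 → ℝ

/-- The set `G` of admissible states: positive density and positive `E - m² / (2ρ)`. -/
def G : Set State := {U | 0 < U 0 ∧ 0 < U 2 - (U 1) ^ 2 / (2 * U 0)}

/-- Velocity `u = m / ρ`. -/
def velocity (U : State) : ℝ := U 1 / U 0

/-- Specific internal energy `e = (E - m² / (2ρ)) / ρ`. -/
def internalEnergy (U : State) : ℝ := (U 2 - (U 1) ^ 2 / (2 * U 0)) / U 0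

/-- Ideal-gas pressure `p = (γ - 1) (E - m² / (2ρ))`. -/
def pressure (γ : ℝ) (U : State) : ℝ := (γ - 1) * (U 2 - (U 1) ^ 2 / (2 * U 0))

/-- Sound speed `√(γ p / ρ)`. -/
def soundSpeed (γ : ℝ) (U : State) : ℝ := Real.sqrt (γ * pressure γ U / U 0)

/-- The Euler flux `F(U) = (ρ u, ρ u² + p, (E + p) u)`. -/
def eulerFlux (γ : ℝ) (U : State) : State :=
  ![U 0 * velocity U,
    U 0 * velocity U ^ 2 + pressure γ U,
    (U 2 + pressure γ U) * velocity U]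

/-- `α_max(U) = |u| + √(γ p / ρ)`. -/
def alphaMax (γ : ℝ) (U : State) : ℝ := |velocity U| + soundSpeed γ U

/-! ## The HLLC flux -/

/-- `S_L`, the smaller of `u - √(γ p / ρ)` over the two states. -/
def speedL (γ : ℝ) (UL UR : State) : ℝ :=
  min (velocity UL - soundSpeed γ UL) (velocity UR - soundSpeed γ UR)

/-- `S_R`, the larger of `u + √(γ p / ρ)` over the two states. -/
def speedR (γ : ℝ) (UL UR : State) : ℝ :=
  max (velocity UL + soundSpeed γ UL) (velocity UR + soundSpeed γ UR)

/-- The middle wave speed `S_*`. -/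
def speedStar (γ : ℝ) (UL UR : State) : ℝ :=
  (pressure γ UR - pressure γ UL
      + UL 0 * velocity UL * (speedL γ UL UR - velocity UL)
      - UR 0 * velocity UR * (speedR γ UL UR - velocity UR)) /
    (UL 0 * (speedL γ UL UR - velocity UL) - UR 0 * (speedR γ UL UR - velocity UR))

/-- The intermediate state `U_{*i}` next to `U = U_i`, with outer wave speed `S = S_i`
and middle wave speed `Sstar = S_*`. -/
def starState (γ : ℝ) (U : State) (S Sstar : ℝ) : State :=
  (U 0 * ((S - velocity U) / (S - Sstar))) •
    ![1,
      Sstar,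
      U 2 / U 0 +
        (Sstar - velocity U) * (Sstar + pressure γ U / (U 0 * (S - velocity U)))]

/-- The intermediate flux `F_{*i} = F(U_i) + S_i (U_{*i} - U_i)`. -/
def starFlux (γ : ℝ) (U : State) (S Sstar : ℝ) : State :=
  eulerFlux γ U + S • (starState γ U S Sstar - U)

/-- The HLLC numerical flux `F^hllc(U_L, U_R)`. -/
def hllc (γ : ℝ) (UL UR : State) : State :=
  if 0 ≤ speedL γ UL UR then eulerFlux γ UL
  else if 0 ≤ speedStar γ UL UR then starFlux γ UL (speedL γ UL UR) (speedStar γ UL UR)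
  else if 0 ≤ speedR γ UL UR then starFlux γ UR (speedR γ UL UR) (speedStar γ UL UR)
  else eulerFlux γ UR

/-! ## Quadrature rules on the reference interval `[-1, 1]` -/

/-- An `n`-point quadrature rule on `[-1, 1]`; the weights are normalised to the averaging
functional `f ↦ ½ ∫_{-1}^{1} f`. -/
structure QuadRule (n : ℕ) where
  node : Fin n → ℝ
  weight : Fin n → ℝ

/-- `r` integrates all polynomials of degree less than `d` exactly. -/
def QuadRule.ExactBelow {n : ℕ} (r : QuadRule n) (d : ℕ) : Prop :=
  ∀ q : ℝ[X], q.degree < d →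
    ∑ i, r.weight i * q.eval (r.node i) = (1 / 2) * ∫ t in (-1 : ℝ)..1, q.eval t

/-- The `n`-point Gauss rule: the `n`-point rule, with nodes in increasing order, of degree of
exactness `2n - 1`. -/
structure QuadRule.IsGauss {n : ℕ} (r : QuadRule n) : Prop where
  strictMono_node : StrictMono r.node
  exact : r.ExactBelow (2 * n)

/-- The `n`-point Gauss–Lobatto rule (`n ≥ 2`): the `n`-point rule, with nodes in increasing
order, that contains both endpoints and has degree of exactness `2n - 3`. -/
structure QuadRule.IsGaussLobatto {n : ℕ} (r : QuadRule n) : Prop where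
  two_le : 2 ≤ n
  strictMono_node : StrictMono r.node
  first_node : ∀ i : Fin n, (i : ℕ) = 0 → r.node i = -1
  last_node : ∀ i : Fin n, (i : ℕ) + 1 = n → r.node i = 1
  exact : r.ExactBelow (2 * n - 2)

/-! ## Mesh and discontinuous piecewise polynomials

The mesh is given by its nodes `x : ℤ → ℝ`; the cell with index `j` is `I_j = (x j, x (j + 1))`,
so `x j` stands for `x_{j-1/2}` and `x (j + 1)` for `x_{j+1/2}`. A set `J` of indices singles out
the cells that make up the spatial domain `Ω`; when `Ω` has a boundary, the cells outside `J` that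
are adjacent to `Ω` are ghost cells whose traces carry the boundary conditions. -/

/-- Length `h_j` of the cell `j`. -/
def cellSize (x : ℤ → ℝ) (j : ℤ) : ℝ := x (j + 1) - x j

/-- The point of the cell `j` which corresponds to the reference point `t ∈ [-1, 1]`. -/
def cellPoint (x : ℤ → ℝ) (j : ℤ) (t : ℝ) : ℝ :=
  (x j + x (j + 1)) / 2 + cellSize x j / 2 * t

/-- A scalar discontinuous piecewise polynomial, given by its polynomial on each cell. -/
abbrev PiecewisePoly : Type := ℤ → ℝ[X]

/-- A vector-valued piecewise polynomial, such as `U_h = (ρ_h, m_h, E_h)`. -/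
abbrev PiecewiseState : Type := ℤ → Fin 3 → ℝ[X]

/-- Membership in the space `V_h^k`: degree at most `k` on every cell of `Ω`. -/
def InVh (J : Set ℤ) (k : ℕ) (w : PiecewisePoly) : Prop :=
  ∀ j ∈ J, (w j).degree ≤ k

/-- Membership in `[V_h^k]³`. -/
def InVh3 (J : Set ℤ) (k : ℕ) (U : PiecewiseState) : Prop :=
  ∀ i : Fin 3, InVh J k (fun j => U j i)

/-- Value at the point `y` of the polynomial vector that `U` has on the cell `j`. At `y = x j`
and `y = x (j + 1)` this is the trace from inside the cell. -/
def valueAt (U : PiecewiseState) (j : ℤ) (y : ℝ) : State := fun i => (U j i).eval y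

/-- Cell average of a scalar piecewise polynomial. -/
def cellAverage (x : ℤ → ℝ) (w : PiecewisePoly) (j : ℤ) : ℝ :=
  (1 / cellSize x j) * ∫ y in (x j)..(x (j + 1)), (w j).eval y

/-- Cell average of a vector-valued piecewise polynomial. -/
def stateAverage (x : ℤ → ℝ) (U : PiecewiseState) (j : ℤ) : State :=
  fun i => cellAverage x (fun l => U l i) j

/-- The set `𝕊_j` of all Gauss–Lobatto points and all Gauss points of the cell `j`. -/
def pointSet {N L : ℕ} (gauss : QuadRule N) (lobatto : QuadRule L) (x : ℤ → ℝ) (j : ℤ) : Set ℝ :=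
  Set.range (fun ν => cellPoint x j (lobatto.node ν)) ∪
    Set.range (fun μ => cellPoint x j (gauss.node μ))

/-! ## The well-balanced DG scheme

The interface at `x j` (between the cells `j - 1` and `j`) has index `j`. -/

/-- The approximation `p^{e,⋆}` of the equilibrium pressure at the interface `j`: the mean of the
two one-sided limits of `p^e_h`. -/
def pStar (x : ℤ → ℝ) (pe : PiecewisePoly) (j : ℤ) : ℝ :=
  ((pe (j - 1)).eval (x j) + (pe j).eval (x j)) / 2

/-- The jump of `p^e_h` (right limit minus left limit) at the interface `j`. -/
def jump (x : ℤ → ℝ) (pe : PiecewisePoly) (j : ℤ) : ℝ :=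
  (pe j).eval (x j) - (pe (j - 1)).eval (x j)

/-- The modified HLLC flux at the interface `j`. -/
def modifiedFlux (γ : ℝ) (x : ℤ → ℝ) (pe : PiecewisePoly) (U : PiecewiseState) (j : ℤ) : State :=
  hllc γ
    ((pStar x pe j / (pe (j - 1)).eval (x j)) • valueAt U (j - 1) (x j))
    ((pStar x pe j / (pe j).eval (x j)) • valueAt U j (x j))

/-- The discrete source functional: `⟨S^[2], v⟩_j` for `q = ρ_h` and `⟨S^[3], v⟩_j` for
`q = m_h`. -/
def sourceForm {N : ℕ} (gauss : QuadRule N) (x : ℤ → ℝ) (ρe pe q : PiecewisePoly)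
    (j : ℤ) (v : ℝ[X]) : ℝ :=
  cellSize x j * ∑ μ, gauss.weight μ *
      (((q j).eval (cellPoint x j (gauss.node μ)) / (ρe j).eval (cellPoint x j (gauss.node μ))
          - cellAverage x q j / cellAverage x ρe j)
        * (derivative (pe j)).eval (cellPoint x j (gauss.node μ))
        * v.eval (cellPoint x j (gauss.node μ)))
    + cellAverage x q j / cellAverage x ρe j *
      (pStar x pe (j + 1) * v.eval (x (j + 1)) - pStar x pe j * v.eval (x j)
        - cellSize x j * ∑ μ, gauss.weight μ *
            ((pe j).eval (cellPoint x j (gauss.node μ))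
              * (derivative v).eval (cellPoint x j (gauss.node μ))))

/-- The vector `(0, ⟨S^[2], v⟩_j, ⟨S^[3], v⟩_j)`. -/
def sourceVector {N : ℕ} (gauss : QuadRule N) (x : ℤ → ℝ) (ρe pe : PiecewisePoly)
    (U : PiecewiseState) (j : ℤ) (v : ℝ[X]) : State :=
  ![0,
    sourceForm gauss x ρe pe (fun l => U l 0) j v,
    sourceForm gauss x ρe pe (fun l => U l 1) j v]

/-- Right-hand side of the semi-discrete weak form on the cell `j`, tested with `v`. -/
def weakRHS {N : ℕ} (γ : ℝ) (gauss : QuadRule N) (x : ℤ → ℝ) (ρe pe : PiecewisePoly)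
    (U : PiecewiseState) (j : ℤ) (v : ℝ[X]) : State :=
  cellSize x j • (∑ μ, (gauss.weight μ * (derivative v).eval (cellPoint x j (gauss.node μ))) •
      eulerFlux γ (valueAt U j (cellPoint x j (gauss.node μ))))
    - (v.eval (x (j + 1)) • modifiedFlux γ x pe U (j + 1)
        - v.eval (x j) • modifiedFlux γ x pe U j)
    + sourceVector gauss x ρe pe U j v

/-- `Unew ∈ [V_h^k]³` results from `U` by one forward-Euler step `Δt` of the DG scheme of
degree `k`, i.e. the weak form holds for all test functions with the time derivative replaced by
`(Unew - U) / Δt`. -/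
def IsForwardEulerStep {N : ℕ} (J : Set ℤ) (k : ℕ) (γ : ℝ) (gauss : QuadRule N) (x : ℤ → ℝ)
    (ρe pe : PiecewisePoly) (Δt : ℝ) (U Unew : PiecewiseState) : Prop :=
  InVh3 J k Unew ∧
    ∀ j ∈ J, ∀ v : ℝ[X], v.degree ≤ k → ∀ i : Fin 3,
      ∫ y in (x j)..(x (j + 1)), (Unew j i).eval y * v.eval y =
        (∫ y in (x j)..(x (j + 1)), (U j i).eval y * v.eval y)
          + Δt * weakRHS γ gauss x ρe pe U j v i

/-- The evolution operator of the cell averages,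
`L_j(U_h) = -(1 / h_j) (F̂_{j+1/2} - F̂_{j-1/2}) + (1 / h_j) (0, ⟨S^[2], 1⟩_j, ⟨S^[3], 1⟩_j)`. -/
def averageOperator {N : ℕ} (γ : ℝ) (gauss : QuadRule N) (x : ℤ → ℝ) (ρe pe : PiecewisePoly)
    (U : PiecewiseState) (j : ℤ) : State :=
  -((1 / cellSize x j) • (modifiedFlux γ x pe U (j + 1) - modifiedFlux γ x pe U j))
    + (1 / cellSize x j) • sourceVector gauss x ρe pe U j 1

/-! ## The CFL condition -/

/-- The normalised endpoint weight `ω̂₁ = 1 / (L (L - 1))` of the `L`-point Gauss–Lobatto rule. -/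
def omegaHat (L : ℕ) : ℝ := 1 / ((L : ℝ) * ((L : ℝ) - 1))

/-- `α̃_j^F`. -/
def alphaF (γ : ℝ) (x : ℤ → ℝ) (pe : PiecewisePoly) (U : PiecewiseState) (j : ℤ) : ℝ :=
  2 * max (pStar x pe (j + 1) / (pe j).eval (x (j + 1))) (pStar x pe j / (pe j).eval (x j))
    * max
        (max (alphaMax γ (valueAt U (j - 1) (x j))) (alphaMax γ (valueAt U j (x j))))
        (max (alphaMax γ (valueAt U j (x (j + 1))))
          (alphaMax γ (valueAt U (j + 1) (x (j + 1)))))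

/-- `α̃_j^S`; the supremum over the finitely many Gauss points is a maximum. -/
def alphaS {N : ℕ} (L : ℕ) (gauss : QuadRule N) (x : ℤ → ℝ) (ρe pe : PiecewisePoly)
    (U : PiecewiseState) (j : ℤ) : ℝ :=
  omegaHat L * cellSize x j *
    ⨆ μ : Fin N,
      |(derivative (pe j)).eval (cellPoint x j (gauss.node μ))| /
        ((ρe j).eval (cellPoint x j (gauss.node μ)) *
          Real.sqrt (2 * internalEnergy (valueAt U j (cellPoint x j (gauss.node μ)))))

/-- `ᾱ_j^S`. -/
def alphaSBar (L : ℕ) (x : ℤ → ℝ) (ρe pe : PiecewisePoly) (U : PiecewiseState) (j : ℤ) : ℝ :=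
  omegaHat L *
    (|jump x pe (j + 1) + jump x pe j| /
      (2 * cellAverage x ρe j * Real.sqrt (2 * internalEnergy (stateAverage x U j))))

/-- `α̃_j = α̃_j^F + α̃_j^S + ᾱ_j^S`. -/
def alphaTilde {N : ℕ} (L : ℕ) (γ : ℝ) (gauss : QuadRule N) (x : ℤ → ℝ) (ρe pe : PiecewisePoly)
    (U : PiecewiseState) (j : ℤ) : ℝ :=
  alphaF γ x pe U j + alphaS L gauss x ρe pe U j + alphaSBar L x ρe pe U j

end

end WBDG

/-! The set `G` is the interior of a convex cone, a Lorentz cone in the variables (ρ, m, E), and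
adding an element of the closure to an element of `G` stays in `G` (`add_mem_G`). It is therefore
enough to write the updated average as a sum of vectors in the closed cone, at least one of them in
`G`.

The CFL condition allows the old average to be split into fractions θF, θS, θB, proportional to the
three parts of α̃, and a nonnegative remainder. The fraction θF is expanded by the Gauss–Lobatto
rule. Its endpoint weight ω̂₁ gives each trace exactly the multiple needed to absorb its interface
flux (`flux_update_mem_G`), while interior nodes contribute with positive weights. The fraction θS
is expanded by the Gauss rule and absorbs the source node by node. The fraction θB stays an average
and absorbs the source produced by the jumps of the equilibrium pressure. Both source estimates are
`add_source_mem_closedCone`.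

A trace absorbs its flux for two reasons. First, `aU ± F(U)` is admissible for `a ≥ α_max`. Second,
the HLLC fan consists of admissible states joined by jump relations, so its integral over half of
`[-a, a]` lies in the cone. Each costs one multiple `a`, whence the factor 2 in `alphaF`.

The quadrature facts used, positivity of the weights and the value of ω̂₁, are derived from the
degree of exactness alone. -/

namespace WBDG

/-! ## The cone of admissible states -/

/-- The closed convex cone `{ρ ≥ 0, E ≥ 0, m² ≤ 2ρE}`, the closure of `G`. -/
def closedCone : Set State := {U | 0 ≤ U 0 ∧ 0 ≤ U 2 ∧ U 1 ^ 2 ≤ 2 * U 0 * U 2}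

theorem mem_G_iff {U : State} : U ∈ G ↔ 0 < U 0 ∧ U 1 ^ 2 < 2 * U 0 * U 2 := by
  unfold G
  simp only [Set.mem_ofPred_eq]
  refine and_congr_right fun h => ?_
  rw [sub_pos, div_lt_iff₀ (by positivity)]
  constructor <;> intro h' <;> linarith

theorem energy_pos {U : State} (h : U ∈ G) : 0 < U 2 := by
  rw [mem_G_iff] at h
  obtain ⟨h0, h1⟩ := h
  by_contra! hc
  nlinarith [sq_nonneg (U 1), mul_nonneg h0.le (neg_nonneg.2 hc)]

theorem mem_closedCone_of_mem_G {U : State} (h : U ∈ G) : U ∈ closedCone :=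
  ⟨h.1.le, (energy_pos h).le, (mem_G_iff.1 h).2.le⟩

theorem smul_mem_G {U : State} (h : U ∈ G) {c : ℝ} (hc : 0 < c) : c • U ∈ G := by
  rw [mem_G_iff] at *
  obtain ⟨h0, h1⟩ := h
  simp only [Pi.smul_apply, smul_eq_mul]
  refine ⟨by positivity, ?_⟩
  have := mul_lt_mul_of_pos_left h1 (show 0 < c ^ 2 by positivity)
  linarith

theorem smul_mem_closedCone {U : State} (h : U ∈ closedCone) {c : ℝ} (hc : 0 ≤ c) :
    c • U ∈ closedCone := by
  obtain ⟨h0, h2, h1⟩ := h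
  refine ⟨mul_nonneg hc h0, mul_nonneg hc h2, ?_⟩
  simp only [Pi.smul_apply, smul_eq_mul]
  have := mul_le_mul_of_nonneg_left h1 (show 0 ≤ c ^ 2 by positivity)
  linarith

/-- The polarised cone inequality, by Cauchy–Schwarz and AM–GM: (U₁V₁)² ≤ 4(U₀V₂)(V₀U₂) ≤ (U₀V₂ +
V₀U₂)². It controls the cross term when cone elements are added. -/
theorem mul_momentum_le {U V : State} (hU : U ∈ closedCone) (hV : V ∈ closedCone) :
    U 1 * V 1 ≤ U 0 * V 2 + V 0 * U 2 := by
  obtain ⟨h0, h2, h1⟩ := hU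
  obtain ⟨k0, k2, k1⟩ := hV
  refine le_of_abs_le (abs_le_of_sq_le_sq ?_ (by positivity))
  have := mul_le_mul h1 k1 (sq_nonneg _) (by positivity)
  nlinarith [sq_nonneg (U 0 * V 2 - V 0 * U 2)]

theorem add_mem_closedCone {U V : State} (hU : U ∈ closedCone) (hV : V ∈ closedCone) :
    U + V ∈ closedCone := by
  have h := mul_momentum_le hU hV
  refine ⟨add_nonneg hU.1 hV.1, add_nonneg hU.2.1 hV.2.1, ?_⟩
  have h1 := hU.2.2
  have h2 := hV.2.2
  simp only [Pi.add_apply]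
  linarith

theorem add_mem_G {U V : State} (hU : U ∈ G) (hV : V ∈ closedCone) : U + V ∈ G := by
  have h := mul_momentum_le (mem_closedCone_of_mem_G hU) hV
  rw [mem_G_iff] at *
  refine ⟨add_pos_of_pos_of_nonneg hU.1 hV.1, ?_⟩
  have h1 := hU.2
  have h2 := hV.2.2
  simp only [Pi.add_apply]
  linarith

theorem zero_mem_closedCone : (0 : State) ∈ closedCone := by simp [closedCone]

theorem sum_mem_closedCone {ι : Type*} (s : Finset ι) (f : ι → State)
    (h : ∀ i ∈ s, f i ∈ closedCone) : ∑ i ∈ s, f i ∈ closedCone :=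
  Finset.sum_induction f (· ∈ closedCone) (fun _ _ => add_mem_closedCone) zero_mem_closedCone h

theorem sum_mem_G {ι : Type*} [Fintype ι] [Nonempty ι] (f : ι → State) (h : ∀ i, f i ∈ G) :
    ∑ i, f i ∈ G := by
  classical
  obtain ⟨i⟩ := ‹Nonempty ι›
  rw [← Finset.add_sum_erase _ _ (Finset.mem_univ i)]
  exact add_mem_G (h i) (sum_mem_closedCone _ _ fun j _ => mem_closedCone_of_mem_G (h j))

/-! ## Primitive variables -/

theorem internalEnergy_pos {U : State} (h : U ∈ G) : 0 < internalEnergy U :=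
  div_pos h.2 h.1

theorem momentum_eq {U : State} (h : U ∈ G) : U 1 = U 0 * velocity U := by
  have := h.1.ne'
  unfold velocity
  field_simp

theorem energy_eq {U : State} (h : U ∈ G) :
    U 2 = U 0 * (internalEnergy U + velocity U ^ 2 / 2) := by
  have := h.1.ne'
  unfold internalEnergy velocity
  field_simp
  ring

theorem pressure_eq (γ : ℝ) {U : State} (h : U ∈ G) :
    pressure γ U = (γ - 1) * U 0 * internalEnergy U := by
  have := h.1.ne'
  unfold internalEnergy pressure
  field_simp

theorem pressure_pos {γ : ℝ} (hγ : 1 < γ) {U : State} (h : U ∈ G) : 0 < pressure γ U :=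
  mul_pos (by linarith) h.2

theorem soundSpeed_pos {γ : ℝ} (hγ : 1 < γ) {U : State} (h : U ∈ G) : 0 < soundSpeed γ U :=
  Real.sqrt_pos.2 (div_pos (mul_pos (by linarith) (pressure_pos hγ h)) h.1)

theorem density_mul_soundSpeed_sq {γ : ℝ} (hγ : 1 < γ) {U : State} (h : U ∈ G) :
    U 0 * soundSpeed γ U ^ 2 = γ * pressure γ U := by
  have h0 := h.1
  have hp := pressure_pos hγ h
  unfold soundSpeed
  rw [Real.sq_sqrt (by positivity)]
  field_simp

/-- Since p = (γ-1)ρe, γ - 1 < 2γ and ρc² = γp, one has p² < ρ²c²·2e. This is the only comparison of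
sound speed with internal energy needed below. -/
theorem pressure_sq_lt {γ : ℝ} (hγ : 1 < γ) {U : State} (h : U ∈ G) {s : ℝ}
    (hs : soundSpeed γ U ≤ s) :
    pressure γ U ^ 2 < s ^ 2 * U 0 ^ 2 * (2 * internalEnergy U) := by
  have h0 := h.1
  have he := internalEnergy_pos h
  have hp := pressure_pos hγ h
  have hc := soundSpeed_pos hγ h
  have hs2 : soundSpeed γ U ^ 2 ≤ s ^ 2 := by gcongr
  calc pressure γ U ^ 2 = pressure γ U * ((γ - 1) * (U 0 * internalEnergy U)) := by
        rw [sq]; nth_rw 2 [pressure_eq γ h]; ring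
    _ < pressure γ U * ((2 * γ) * (U 0 * internalEnergy U)) := by
        gcongr
        linarith
    _ = (U 0 * soundSpeed γ U ^ 2) * (2 * U 0 * internalEnergy U) := by
        rw [density_mul_soundSpeed_sq hγ h]; ring
    _ ≤ (U 0 * s ^ 2) * (2 * U 0 * internalEnergy U) := by gcongr
    _ = _ := by ring

theorem velocity_smul {c : ℝ} (hc : 0 < c) (U : State) : velocity (c • U) = velocity U := by
  simp only [velocity, Pi.smul_apply, smul_eq_mul]
  exact mul_div_mul_left _ _ hc.ne'

theorem alphaMax_smul (γ : ℝ) {c : ℝ} (hc : 0 < c) {U : State} (h : U ∈ G) :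
    alphaMax γ (c • U) = alphaMax γ U := by
  have h0 := h.1.ne'
  unfold alphaMax soundSpeed pressure
  rw [velocity_smul hc]
  simp only [Pi.smul_apply, smul_eq_mul]
  congr 2
  field_simp

theorem alphaMax_pos {γ : ℝ} (hγ : 1 < γ) {U : State} (h : U ∈ G) : 0 < alphaMax γ U :=
  add_pos_of_nonneg_of_pos (abs_nonneg _) (soundSpeed_pos hγ h)

/-! ## Splitting of the Euler flux -/

theorem eulerFlux_eq (γ : ℝ) {U : State} (h : U ∈ G) :
    eulerFlux γ U = velocity U • U + pressure γ U • ![0, 1, velocity U] := by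
  have hm := momentum_eq h
  funext i
  fin_cases i
  · simp [eulerFlux]; ring
  · simp [eulerFlux]; rw [hm]; ring
  · simp [eulerFlux]; ring

/-- For this vector 2ρE - m² equals s²ρ²·2e - p²: all terms containing u cancel. With s = a ∓ u and
r = ∓1 it is `aU ∓ F(U)`. -/
theorem smul_add_pressure_mem_G {γ : ℝ} (hγ : 1 < γ) {U : State} (h : U ∈ G) {s : ℝ}
    (hs : soundSpeed γ U ≤ s) {r : ℝ} (hr : r ^ 2 = 1) :
    s • U + (r * pressure γ U) • ![0, 1, velocity U] ∈ G := by
  have hc := soundSpeed_pos hγ h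
  have hp := pressure_sq_lt hγ h hs
  have h0 := h.1
  rw [mem_G_iff]
  have hm := momentum_eq h
  have hE := energy_eq h
  simp only [Pi.add_apply, Pi.smul_apply, smul_eq_mul, Matrix.cons_val]
  refine ⟨by rw [mul_zero, add_zero]; exact mul_pos (hc.trans_le hs) h0, ?_⟩
  rw [hm, hE]
  have : (r * pressure γ U) ^ 2 < s ^ 2 * U 0 ^ 2 * (2 * internalEnergy U) := by
    rw [mul_pow, hr, one_mul]; exact hp
  linarith

theorem smul_sub_eulerFlux_mem_G {γ : ℝ} (hγ : 1 < γ) {U : State} (h : U ∈ G) {a : ℝ}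
    (ha : alphaMax γ U ≤ a) : a • U - eulerFlux γ U ∈ G := by
  have hs : soundSpeed γ U ≤ a - velocity U := by
    have := le_abs_self (velocity U)
    unfold alphaMax at ha
    linarith
  have := smul_add_pressure_mem_G hγ h hs (r := -1) (by norm_num)
  rw [eulerFlux_eq γ h]
  convert this using 1
  module

theorem smul_add_eulerFlux_mem_G {γ : ℝ} (hγ : 1 < γ) {U : State} (h : U ∈ G) {a : ℝ}
    (ha : alphaMax γ U ≤ a) : a • U + eulerFlux γ U ∈ G := by
  have hs : soundSpeed γ U ≤ a + velocity U := by
    have := neg_abs_le (velocity U)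
    unfold alphaMax at ha
    linarith
  have := smul_add_pressure_mem_G hγ h hs (r := 1) (by norm_num)
  rw [eulerFlux_eq γ h]
  convert this using 1
  module

/-! ## The HLLC approximate Riemann solver -/

/-- After removal of the positive factor and with r = p/(ρ(S-u)), the quantity 2E - T² becomes
(T-u+r)² + (2e - r²), and `pressure_sq_lt` gives r² < 2e. -/
theorem starState_mem_G {γ : ℝ} (hγ : 1 < γ) {U : State} (h : U ∈ G) {S T : ℝ}
    (hS : soundSpeed γ U ≤ |S - velocity U|) (hT : 0 < (S - velocity U) / (S - T)) :
    starState γ U S T ∈ G := by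
  have h0 := h.1
  have hc := soundSpeed_pos hγ h
  have hd : S - velocity U ≠ 0 := abs_pos.1 (hc.trans_le hS)
  refine smul_mem_G (mem_G_iff.2 ⟨?_, ?_⟩) (mul_pos h0 hT)
  · simp
  simp only [Matrix.cons_val]
  have hE : U 2 / U 0 = internalEnergy U + velocity U ^ 2 / 2 := by
    rw [energy_eq h]; field_simp
  rw [hE]
  have hr : (pressure γ U / (U 0 * (S - velocity U))) ^ 2 < 2 * internalEnergy U := by
    rw [div_pow, div_lt_iff₀ (by positivity)]
    have := pressure_sq_lt hγ h hS
    rw [sq_abs] at this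
    linarith
  nlinarith [sq_nonneg (T - velocity U + pressure γ U / (U 0 * (S - velocity U)))]

/-- The flux of the intermediate state in terms of the contact pressure. -/
theorem starFlux_eq (γ : ℝ) {U : State} (h : U ∈ G) {S T : ℝ} (hS : S - velocity U ≠ 0)
    (hT : S - T ≠ 0) :
    starFlux γ U S T = T • starState γ U S T +
      (pressure γ U + U 0 * (S - velocity U) * (T - velocity U)) • ![0, 1, T] := by
  have h0 := h.1.ne'
  have hm := momentum_eq h
  unfold starFlux starState
  funext i
  fin_cases i
  · simp [eulerFlux, Matrix.vecHead, Matrix.vecTail]; field_simp; ring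
  · simp [eulerFlux, Matrix.vecHead, Matrix.vecTail]; rw [hm]; field_simp; ring
  · simp [eulerFlux, Matrix.vecHead, Matrix.vecTail]; field_simp; ring

section Riemann

variable {γ : ℝ} {UL UR : State}

/-! ### Bounds and ordering of the three wave speeds. -/

theorem soundSpeed_le_velocity_sub_speedL (γ : ℝ) (UL UR : State) :
    soundSpeed γ UL ≤ velocity UL - speedL γ UL UR := by
  have := min_le_left (velocity UL - soundSpeed γ UL) (velocity UR - soundSpeed γ UR)
  unfold speedL
  linarith

theorem soundSpeed_le_velocity_sub_speedL' (γ : ℝ) (UL UR : State) :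
    soundSpeed γ UR ≤ velocity UR - speedL γ UL UR := by
  have := min_le_right (velocity UL - soundSpeed γ UL) (velocity UR - soundSpeed γ UR)
  unfold speedL
  linarith

theorem soundSpeed_le_speedR_sub_velocity (γ : ℝ) (UL UR : State) :
    soundSpeed γ UR ≤ speedR γ UL UR - velocity UR := by
  have := le_max_right (velocity UL + soundSpeed γ UL) (velocity UR + soundSpeed γ UR)
  unfold speedR
  linarith

theorem soundSpeed_le_speedR_sub_velocity' (γ : ℝ) (UL UR : State) :
    soundSpeed γ UL ≤ speedR γ UL UR - velocity UL := by
  have := le_max_left (velocity UL + soundSpeed γ UL) (velocity UR + soundSpeed γ UR)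
  unfold speedR
  linarith

theorem neg_speedL_le {a : ℝ} (hL : alphaMax γ UL ≤ a) (hR : alphaMax γ UR ≤ a) :
    -speedL γ UL UR ≤ a := by
  have h1 := neg_abs_le (velocity UL)
  have h2 := neg_abs_le (velocity UR)
  unfold alphaMax at hL hR
  have : -a ≤ speedL γ UL UR := le_min (by linarith) (by linarith)
  linarith

theorem speedR_le {a : ℝ} (hL : alphaMax γ UL ≤ a) (hR : alphaMax γ UR ≤ a) :
    speedR γ UL UR ≤ a := by
  have h1 := le_abs_self (velocity UL)
  have h2 := le_abs_self (velocity UR)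
  unfold alphaMax at hL hR
  exact max_le (by linarith) (by linarith)

theorem speedStar_denom_neg (hγ : 1 < γ) (hUL : UL ∈ G) (hUR : UR ∈ G) :
    UL 0 * (speedL γ UL UR - velocity UL) - UR 0 * (speedR γ UL UR - velocity UR) < 0 := by
  have h1 := soundSpeed_le_velocity_sub_speedL γ UL UR
  have h2 := soundSpeed_le_speedR_sub_velocity γ UL UR
  have h3 := soundSpeed_pos hγ hUL
  have h4 := soundSpeed_pos hγ hUR
  have h5 := mul_pos hUL.1 (h3.trans_le h1)
  have h6 := mul_pos hUR.1 (h4.trans_le h2)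
  linarith

theorem speedStar_mul (hγ : 1 < γ) (hUL : UL ∈ G) (hUR : UR ∈ G) :
    speedStar γ UL UR *
      (UL 0 * (speedL γ UL UR - velocity UL) - UR 0 * (speedR γ UL UR - velocity UR)) =
    pressure γ UR - pressure γ UL
      + UL 0 * velocity UL * (speedL γ UL UR - velocity UL)
      - UR 0 * velocity UR * (speedR γ UL UR - velocity UR) :=
  div_mul_cancel₀ _ (speedStar_denom_neg hγ hUL hUR).ne

/-- Follows from ρc² = γp > p. It needs both outer speeds to be at least a sound speed away from the
same velocity, which is why they are extrema over both states. -/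
theorem pressure_lt_mul (hγ : 1 < γ) {U : State} (h : U ∈ G) {s t : ℝ}
    (hs : soundSpeed γ U ≤ s) (ht : soundSpeed γ U ≤ t) : pressure γ U < U 0 * s * t := by
  have hp := pressure_pos hγ h
  have hc := soundSpeed_pos hγ h
  have h0 := h.1
  have := density_mul_soundSpeed_sq hγ h
  have h1 : soundSpeed γ U * soundSpeed γ U ≤ s * t := mul_le_mul hs ht hc.le (hc.le.trans hs)
  have h2 := mul_le_mul_of_nonneg_left h1 h0.le
  nlinarith

theorem speedL_lt_speedStar (hγ : 1 < γ) (hUL : UL ∈ G) (hUR : UR ∈ G) :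
    speedL γ UL UR < speedStar γ UL UR := by
  have hD := speedStar_denom_neg hγ hUL hUR
  rw [speedStar, lt_div_iff_of_neg hD]
  have h1 := pressure_lt_mul hγ hUR (soundSpeed_le_speedR_sub_velocity γ UL UR)
    (soundSpeed_le_velocity_sub_speedL' γ UL UR)
  have h2 := pressure_pos hγ hUL
  have h3 := mul_nonneg hUL.1.le (sq_nonneg (speedL γ UL UR - velocity UL))
  linarith

theorem speedStar_lt_speedR (hγ : 1 < γ) (hUL : UL ∈ G) (hUR : UR ∈ G) :
    speedStar γ UL UR < speedR γ UL UR := by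
  have hD := speedStar_denom_neg hγ hUL hUR
  rw [speedStar, div_lt_iff_of_neg hD]
  have h1 := pressure_lt_mul hγ hUL (soundSpeed_le_velocity_sub_speedL γ UL UR)
    (soundSpeed_le_speedR_sub_velocity' γ UL UR)
  have h2 := pressure_pos hγ hUR
  have h3 := mul_nonneg hUR.1.le (sq_nonneg (speedR γ UL UR - velocity UR))
  linarith

/-! ### Intermediate states and jump relations. -/

theorem starState_left_mem_G (hγ : 1 < γ) (hUL : UL ∈ G) (hUR : UR ∈ G) :
    starState γ UL (speedL γ UL UR) (speedStar γ UL UR) ∈ G := by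
  have h1 := soundSpeed_le_velocity_sub_speedL γ UL UR
  have h2 := soundSpeed_pos hγ hUL
  refine starState_mem_G hγ hUL ?_ (div_pos_of_neg_of_neg (by linarith) ?_)
  · rw [abs_sub_comm]
    exact h1.trans (le_abs_self _)
  · exact sub_neg.2 (speedL_lt_speedStar hγ hUL hUR)

theorem starState_right_mem_G (hγ : 1 < γ) (hUL : UL ∈ G) (hUR : UR ∈ G) :
    starState γ UR (speedR γ UL UR) (speedStar γ UL UR) ∈ G := by
  have h1 := soundSpeed_le_speedR_sub_velocity γ UL UR
  have h2 := soundSpeed_pos hγ hUR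
  refine starState_mem_G hγ hUR (h1.trans (le_abs_self _)) (div_pos (by linarith) ?_)
  exact sub_pos.2 (speedStar_lt_speedR hγ hUL hUR)

/-- The Rankine–Hugoniot condition across the contact wave. -/
theorem starFlux_sub (hγ : 1 < γ) (hUL : UL ∈ G) (hUR : UR ∈ G) :
    starFlux γ UR (speedR γ UL UR) (speedStar γ UL UR) =
      starFlux γ UL (speedL γ UL UR) (speedStar γ UL UR) +
        speedStar γ UL UR • (starState γ UR (speedR γ UL UR) (speedStar γ UL UR) -
          starState γ UL (speedL γ UL UR) (speedStar γ UL UR)) := by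
  have h1 := soundSpeed_le_velocity_sub_speedL γ UL UR
  have h2 := soundSpeed_pos hγ hUL
  have h3 := soundSpeed_le_speedR_sub_velocity γ UL UR
  have h4 := soundSpeed_pos hγ hUR
  have h5 := speedL_lt_speedStar hγ hUL hUR
  have h6 := speedStar_lt_speedR hγ hUL hUR
  have h7 := speedStar_mul hγ hUL hUR
  rw [starFlux_eq γ hUL (by linarith) (by linarith),
    starFlux_eq γ hUR (by linarith) (by linarith)]
  -- The defining formula of `speedStar` is exactly equality of the contact pressures on the two
  -- sides.
  have h8 : pressure γ UR
        + UR 0 * (speedR γ UL UR - velocity UR) * (speedStar γ UL UR - velocity UR) =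
      pressure γ UL
        + UL 0 * (speedL γ UL UR - velocity UL) * (speedStar γ UL UR - velocity UL) := by
    linarith
  rw [h8]
  module

/-- The jump relations of all three waves, telescoped: the fan is consistent with the conservation
law. -/
theorem eulerFlux_right_eq (hγ : 1 < γ) (hUL : UL ∈ G) (hUR : UR ∈ G) :
    eulerFlux γ UR = eulerFlux γ UL
      + speedL γ UL UR • (starState γ UL (speedL γ UL UR) (speedStar γ UL UR) - UL)
      + speedStar γ UL UR • (starState γ UR (speedR γ UL UR) (speedStar γ UL UR) -
          starState γ UL (speedL γ UL UR) (speedStar γ UL UR))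
      + speedR γ UL UR • (UR - starState γ UR (speedR γ UL UR) (speedStar γ UL UR)) := by
  have h := starFlux_sub hγ hUL hUR
  unfold starFlux at h
  rw [eq_sub_of_add_eq h]
  module

/-! ### Integrals over the Riemann fan. -/

/-- The vector is the integral of the fan over `[-a, 0]`. In each branch it is a combination of the
fan states, with the lengths of their intervals as coefficients. -/
theorem smul_sub_hllc_mem_closedCone (hγ : 1 < γ) (hUL : UL ∈ G) (hUR : UR ∈ G) {a : ℝ}
    (hL : alphaMax γ UL ≤ a) (hR : alphaMax γ UR ≤ a) :
    a • UL - hllc γ UL UR + eulerFlux γ UL ∈ closedCone := by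
  have ha := neg_speedL_le hL hR
  have h5 := speedL_lt_speedStar hγ hUL hUR
  have h6 := speedStar_lt_speedR hγ hUL hUR
  have hsL := mem_closedCone_of_mem_G (starState_left_mem_G hγ hUL hUR)
  have hsR := mem_closedCone_of_mem_G (starState_right_mem_G hγ hUL hUR)
  have kL := mem_closedCone_of_mem_G hUL
  have kR := mem_closedCone_of_mem_G hUR
  have hF := eulerFlux_right_eq hγ hUL hUR
  have hS := starFlux_sub hγ hUL hUR
  have h0 := (alphaMax_pos hγ hUL).trans_le hL
  unfold hllc
  split_ifs with c1 c2 c3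
  · convert smul_mem_closedCone kL h0.le using 1
    module
  · convert add_mem_closedCone
      (smul_mem_closedCone kL (show 0 ≤ a + speedL γ UL UR by linarith))
      (smul_mem_closedCone hsL (show 0 ≤ -speedL γ UL UR by linarith)) using 1
    unfold starFlux
    module
  · rw [hS]
    convert add_mem_closedCone (add_mem_closedCone
      (smul_mem_closedCone kL (show 0 ≤ a + speedL γ UL UR by linarith))
      (smul_mem_closedCone hsL (show 0 ≤ speedStar γ UL UR - speedL γ UL UR by linarith)))
      (smul_mem_closedCone hsR (show 0 ≤ -speedStar γ UL UR by linarith)) using 1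
    unfold starFlux
    module
  · rw [hF]
    convert add_mem_closedCone (add_mem_closedCone (add_mem_closedCone
      (smul_mem_closedCone kL (show 0 ≤ a + speedL γ UL UR by linarith))
      (smul_mem_closedCone hsL (show 0 ≤ speedStar γ UL UR - speedL γ UL UR by linarith)))
      (smul_mem_closedCone hsR (show 0 ≤ speedR γ UL UR - speedStar γ UL UR by linarith)))
      (smul_mem_closedCone kR (show 0 ≤ -speedR γ UL UR by linarith)) using 1
    module

/-- The mirror image: the integral of the fan over `[0, a]`. -/
theorem smul_add_hllc_mem_closedCone (hγ : 1 < γ) (hUL : UL ∈ G) (hUR : UR ∈ G) {a : ℝ}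
    (hL : alphaMax γ UL ≤ a) (hR : alphaMax γ UR ≤ a) :
    a • UR + hllc γ UL UR - eulerFlux γ UR ∈ closedCone := by
  have ha := speedR_le hL hR
  have h5 := speedL_lt_speedStar hγ hUL hUR
  have h6 := speedStar_lt_speedR hγ hUL hUR
  have hsL := mem_closedCone_of_mem_G (starState_left_mem_G hγ hUL hUR)
  have hsR := mem_closedCone_of_mem_G (starState_right_mem_G hγ hUL hUR)
  have kL := mem_closedCone_of_mem_G hUL
  have kR := mem_closedCone_of_mem_G hUR
  have hF := eulerFlux_right_eq hγ hUL hUR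
  have h0 := (alphaMax_pos hγ hUL).trans_le hL
  unfold hllc
  split_ifs with c1 c2 c3
  · rw [hF]
    convert add_mem_closedCone (add_mem_closedCone (add_mem_closedCone
      (smul_mem_closedCone kL (show 0 ≤ speedL γ UL UR by linarith))
      (smul_mem_closedCone hsL (show 0 ≤ speedStar γ UL UR - speedL γ UL UR by linarith)))
      (smul_mem_closedCone hsR (show 0 ≤ speedR γ UL UR - speedStar γ UL UR by linarith)))
      (smul_mem_closedCone kR (show 0 ≤ a - speedR γ UL UR by linarith)) using 1
    module
  · rw [hF]
    convert add_mem_closedCone (add_mem_closedCone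
      (smul_mem_closedCone hsL (show 0 ≤ speedStar γ UL UR by linarith))
      (smul_mem_closedCone hsR (show 0 ≤ speedR γ UL UR - speedStar γ UL UR by linarith)))
      (smul_mem_closedCone kR (show 0 ≤ a - speedR γ UL UR by linarith)) using 1
    unfold starFlux
    module
  · convert add_mem_closedCone
      (smul_mem_closedCone hsR (show 0 ≤ speedR γ UL UR by linarith))
      (smul_mem_closedCone kR (show 0 ≤ a - speedR γ UL UR by linarith)) using 1
    unfold starFlux
    module
  · convert smul_mem_closedCone kR h0.le using 1
    module

theorem smul_sub_hllc_mem_G (hγ : 1 < γ) (hUL : UL ∈ G) (hUR : UR ∈ G) {a : ℝ}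
    (hL : alphaMax γ UL ≤ a) (hR : alphaMax γ UR ≤ a) :
    (2 * a) • UL - hllc γ UL UR ∈ G := by
  convert add_mem_G (smul_sub_eulerFlux_mem_G hγ hUL hL)
    (smul_sub_hllc_mem_closedCone hγ hUL hUR hL hR) using 1
  module

theorem smul_add_hllc_mem_G (hγ : 1 < γ) (hUL : UL ∈ G) (hUR : UR ∈ G) {a : ℝ}
    (hL : alphaMax γ UL ≤ a) (hR : alphaMax γ UR ≤ a) :
    (2 * a) • UR + hllc γ UL UR ∈ G := by
  convert add_mem_G (smul_add_eulerFlux_mem_G hγ hUR hR)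
    (smul_add_hllc_mem_closedCone hγ hUL hUR hL hR) using 1
  module

end Riemann

/-! ## Admissibility under the gravitational source -/

/-- For the sum, 2ρE - m² equals ρ²(s²·2e - a²), so the bound on a is exactly what is needed. -/
theorem add_source_mem_closedCone {U : State} (h : U ∈ G) {s a : ℝ}
    (ha : |a| ≤ s * Real.sqrt (2 * internalEnergy U)) :
    s • U + a • ![0, U 0, U 1] ∈ closedCone := by
  have h0 := h.1
  have he := internalEnergy_pos h
  have hq : 0 < Real.sqrt (2 * internalEnergy U) := by positivity
  have hs : 0 ≤ s := by
    by_contra! hs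
    have := mul_neg_of_neg_of_pos hs hq
    linarith [abs_nonneg a]
  have hm := momentum_eq h
  have hE := energy_eq h
  have ha2 : a ^ 2 ≤ s ^ 2 * (2 * internalEnergy U) := by
    rw [← sq_abs]
    calc |a| ^ 2 ≤ (s * Real.sqrt (2 * internalEnergy U)) ^ 2 := by gcongr
      _ = _ := by rw [mul_pow, Real.sq_sqrt (by positivity)]
  -- Nonnegativity of the energy is obtained by dividing by sρ, so s = 0 is treated apart.
  rcases hs.eq_or_lt with rfl | hs
  · have : a = 0 := by nlinarith
    simp [this, closedCone]
  have hkey : (s * U 1 + a * U 0) ^ 2 ≤ 2 * (s * U 0) * (s * U 2 + a * U 1) := by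
    rw [hm, hE]
    have := mul_le_mul_of_nonneg_left ha2 (sq_nonneg (U 0))
    linarith
  refine ⟨?_, ?_, ?_⟩
  · simp; positivity
  · simp
    have := (sq_nonneg _).trans hkey
    exact nonneg_of_mul_nonneg_right this (by positivity)
  · simpa using hkey

/-! ## Averages of polynomials over the reference interval -/

/-- The average of a polynomial over `[-1, 1]`. -/
noncomputable def refAverage (q : ℝ[X]) : ℝ := (1 / 2) * ∫ t in (-1 : ℝ)..1, q.eval t

theorem intervalIntegrable_eval (q : ℝ[X]) (a b : ℝ) :
    IntervalIntegrable (fun t => q.eval t) MeasureTheory.volume a b :=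
  q.continuous.intervalIntegrable _ _

theorem refAverage_add (p q : ℝ[X]) : refAverage (p + q) = refAverage p + refAverage q := by
  unfold refAverage
  simp only [eval_add]
  rw [intervalIntegral.integral_add (intervalIntegrable_eval p _ _)
    (intervalIntegrable_eval q _ _)]
  ring

theorem refAverage_C_mul (c : ℝ) (q : ℝ[X]) : refAverage (C c * q) = c * refAverage q := by
  unfold refAverage
  simp only [eval_mul, eval_C]
  rw [intervalIntegral.integral_const_mul]
  ring

theorem refAverage_derivative (q : ℝ[X]) :
    refAverage (derivative q) = (q.eval 1 - q.eval (-1)) / 2 := by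
  unfold refAverage
  rw [intervalIntegral.integral_eq_sub_of_hasDerivAt (fun t _ => q.hasDerivAt t)
    (intervalIntegrable_eval _ _ _)]
  ring

theorem refAverage_derivative_mul (p q : ℝ[X]) :
    refAverage (derivative p * q) =
      (p.eval 1 * q.eval 1 - p.eval (-1) * q.eval (-1)) / 2 - refAverage (p * derivative q) := by
  have h := refAverage_derivative (p * q)
  rw [derivative_mul, refAverage_add] at h
  simp only [eval_mul] at h
  linarith

theorem refAverage_pos {q : ℝ[X]} (hq : q ≠ 0)
    (h : ∀ t ∈ Set.Icc (-1 : ℝ) 1, 0 ≤ q.eval t) : 0 < refAverage q := by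
  refine mul_pos (by norm_num) (intervalIntegral.integral_pos (by norm_num)
    q.continuous.continuousOn (fun t ht => h t (Set.Ioc_subset_Icc_self ht)) ?_)
  by_contra! hc
  refine hq (eq_zero_of_infinite_isRoot q ?_)
  refine (Set.Icc_infinite (show (-1 : ℝ) < 1 by norm_num)).mono fun t ht => ?_
  exact le_antisymm (hc t ht) (h t ht)

/-! ## Weights of quadrature rules -/

theorem QuadRule.ExactBelow.sum_eq {n d : ℕ} {r : QuadRule n} (h : r.ExactBelow d) {q : ℝ[X]}
    (hq : q.degree < d) : ∑ i, r.weight i * q.eval (r.node i) = refAverage q :=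
  h q hq

theorem QuadRule.ExactBelow.refAverage_eq_zero {n d : ℕ} {r : QuadRule n} (h : r.ExactBelow d)
    {q : ℝ[X]} (hq : q.degree < d) (h0 : ∀ i, q.eval (r.node i) = 0) : refAverage q = 0 := by
  rw [← h.sum_eq hq]
  simp [h0]

theorem QuadRule.ExactBelow.weight_mul_eq {n d : ℕ} {r : QuadRule n} (h : r.ExactBelow d)
    {q : ℝ[X]} (hq : q.degree < d) (i : Fin n) (h0 : ∀ j ≠ i, q.eval (r.node j) = 0) :
    r.weight i * q.eval (r.node i) = refAverage q := by
  rw [← h.sum_eq hq, Finset.sum_eq_single i]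
  · intro j _ hj
    rw [h0 j hj, mul_zero]
  · simp

theorem QuadRule.ExactBelow.weight_pos {n d : ℕ} {r : QuadRule n} (h : r.ExactBelow d)
    {q : ℝ[X]} (hq : q.degree < d) (i : Fin n) (h0 : ∀ j ≠ i, q.eval (r.node j) = 0)
    (hne : q ≠ 0) (hi : 0 ≤ q.eval (r.node i))
    (hpos : ∀ t ∈ Set.Icc (-1 : ℝ) 1, 0 ≤ q.eval t) : 0 < r.weight i := by
  have h1 := refAverage_pos hne hpos
  rw [← h.weight_mul_eq hq i h0] at h1
  exact pos_of_mul_pos_left h1 hi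

theorem degree_lt_of_natDegree_lt {q : ℝ[X]} {d : ℕ} (h : q.natDegree < d) : q.degree < d :=
  degree_le_natDegree.trans_lt (by exact_mod_cast h)

/-- The test polynomial is the squared product over the other nodes, of degree 2n - 2. -/
theorem QuadRule.IsGauss.weight_pos {n : ℕ} {r : QuadRule n} (h : r.IsGauss) (i : Fin n) :
    0 < r.weight i := by
  set p : ℝ[X] := ∏ j ∈ Finset.univ.erase i, (X - C (r.node j)) with hp
  have hmonic : p.Monic := monic_prod_of_monic _ _ fun j _ => monic_X_sub_C _
  have hdeg : p.natDegree = n - 1 := by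
    rw [hp, natDegree_finsetProd_X_sub_C_eq_card]
    simp
  have hn : 0 < n := i.pos
  refine h.exact.weight_pos (q := p ^ 2) (degree_lt_of_natDegree_lt ?_) i ?_
    (hmonic.pow 2).ne_zero ?_ ?_
  · rw [natDegree_pow, hdeg]
    omega
  · intro j hj
    have : p.eval (r.node j) = 0 := by
      rw [hp, eval_prod]
      exact Finset.prod_eq_zero (Finset.mem_erase.2 ⟨hj, Finset.mem_univ j⟩) (by simp)
    simp [this]
  · rw [eval_pow]; positivity
  · intro t _
    rw [eval_pow]; positivity

/-! ### Gauss–Lobatto rules -/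

section Lobatto

variable {m : ℕ} {r : QuadRule (m + 2)}

/-- The monic polynomial whose roots are the interior nodes. -/
noncomputable def QuadRule.interiorPoly (r : QuadRule (m + 2)) : ℝ[X] :=
  ∏ i : Fin m, (X - C (r.node i.castSucc.succ))

theorem QuadRule.monic_interiorPoly (r : QuadRule (m + 2)) : r.interiorPoly.Monic :=
  monic_prod_of_monic _ _ fun _ _ => monic_X_sub_C _

theorem QuadRule.natDegree_interiorPoly (r : QuadRule (m + 2)) :
    r.interiorPoly.natDegree = m := by
  unfold QuadRule.interiorPoly
  rw [natDegree_finsetProd_X_sub_C_eq_card]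
  simp

theorem QuadRule.eval_interiorPoly_node (r : QuadRule (m + 2)) (i : Fin m) :
    r.interiorPoly.eval (r.node i.castSucc.succ) = 0 := by
  unfold QuadRule.interiorPoly
  rw [eval_prod]
  exact Finset.prod_eq_zero (Finset.mem_univ i) (by simp)

theorem QuadRule.IsGaussLobatto.node_zero (h : r.IsGaussLobatto) : r.node 0 = -1 :=
  h.first_node 0 rfl

theorem QuadRule.IsGaussLobatto.node_last (h : r.IsGaussLobatto) :
    r.node (Fin.last (m + 1)) = 1 :=
  h.last_node _ rfl

theorem QuadRule.IsGaussLobatto.node_interior (h : r.IsGaussLobatto) (i : Fin m) :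
    -1 < r.node i.castSucc.succ ∧ r.node i.castSucc.succ < 1 := by
  rw [← h.node_zero, ← h.node_last]
  refine ⟨h.strictMono_node (Fin.succ_pos _), h.strictMono_node ?_⟩
  rw [← Fin.succ_last, Fin.succ_lt_succ_iff]
  exact Fin.castSucc_lt_last i

theorem QuadRule.index_cases {motive : Fin (m + 2) → Prop} (first : motive 0)
    (last : motive (Fin.last (m + 1))) (interior : ∀ i : Fin m, motive i.castSucc.succ)
    (i : Fin (m + 2)) : motive i := by
  refine Fin.cases first (fun j => ?_) i
  refine Fin.lastCases ?_ interior j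
  rw [Fin.succ_last]
  exact last

theorem QuadRule.IsGaussLobatto.eval_nodePoly (h : r.IsGaussLobatto) (q : ℝ[X])
    (i : Fin (m + 2)) : ((X ^ 2 - 1) * r.interiorPoly * q).eval (r.node i) = 0 := by
  induction i using QuadRule.index_cases with
  | first => simp [h.node_zero]
  | last => simp [h.node_last]
  | interior i => simp [r.eval_interiorPoly_node]

theorem natDegree_X_sq_sub_one : (X ^ 2 - 1 : ℝ[X]).natDegree = 2 := by
  compute_degree!

theorem monic_X_sq_sub_one : (X ^ 2 - 1 : ℝ[X]).Monic := by
  monicity!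

theorem QuadRule.IsGaussLobatto.refAverage_nodePoly_mul (h : r.IsGaussLobatto) {q : ℝ[X]}
    (hq : q.degree < m) : refAverage ((X ^ 2 - 1) * r.interiorPoly * q) = 0 := by
  refine h.exact.refAverage_eq_zero ?_ (h.eval_nodePoly q)
  rcases eq_or_ne q 0 with rfl | hq0
  · simp [bot_lt_iff_ne_bot]
  have hqn : q.natDegree < m := (natDegree_lt_iff_degree_lt hq0).2 hq
  refine degree_lt_of_natDegree_lt ?_
  have h1 := natDegree_mul_le (p := (X ^ 2 - 1) * r.interiorPoly) (q := q)
  have h2 := natDegree_mul_le (p := (X ^ 2 - 1 : ℝ[X])) (q := r.interiorPoly)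
  rw [natDegree_X_sq_sub_one, r.natDegree_interiorPoly] at h2
  omega

/-- The derivative of the node polynomial is orthogonal to polynomials of lower degree. -/
theorem QuadRule.IsGaussLobatto.refAverage_derivative_nodePoly_mul (h : r.IsGaussLobatto)
    {q : ℝ[X]} (hq : q.natDegree ≤ m) :
    refAverage (derivative ((X ^ 2 - 1) * r.interiorPoly) * q) = 0 := by
  rw [refAverage_derivative_mul]
  have h1 : refAverage ((X ^ 2 - 1) * r.interiorPoly * derivative q) = 0 := by
    rcases eq_or_ne q.natDegree 0 with h0 | h0
    · rw [derivative_of_natDegree_zero h0]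
      simp [refAverage]
    · exact h.refAverage_nodePoly_mul
        (degree_lt_of_natDegree_lt ((natDegree_derivative_lt h0).trans_le hq))
  rw [h1]
  simp

/-- The differential equation of the Legendre polynomials, in terms of the node polynomial. -/
theorem QuadRule.IsGaussLobatto.derivative_derivative_nodePoly (h : r.IsGaussLobatto) :
    derivative (derivative ((X ^ 2 - 1) * r.interiorPoly)) =
      C (((m : ℝ) + 2) * (m + 1)) * r.interiorPoly := by
  set W := (X ^ 2 - 1) * r.interiorPoly with hW
  -- The leading terms cancel, so deg R < m. Then R is shown to be orthogonal to itself for the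
  -- weight 1 - X².
  set R := derivative (derivative W) - C (((m : ℝ) + 2) * (m + 1)) * r.interiorPoly with hR
  have hWm : W.Monic := monic_X_sq_sub_one.mul r.monic_interiorPoly
  have hWd : W.natDegree = m + 2 := by
    rw [hW, monic_X_sq_sub_one.natDegree_mul r.monic_interiorPoly, natDegree_X_sq_sub_one,
      r.natDegree_interiorPoly]
    omega
  have hRd : R.degree < m := by
    rw [degree_lt_iff_coeff_zero]
    intro l hl
    rw [hR, coeff_sub, coeff_C_mul, coeff_derivative, coeff_derivative]
    rcases hl.eq_or_lt with rfl | hl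
    · have h1 : W.coeff (m + 1 + 1) = 1 := by
        have := hWm.coeff_natDegree
        rwa [hWd] at this
      have h2 : r.interiorPoly.coeff m = 1 := by
        have := r.monic_interiorPoly.coeff_natDegree
        rwa [r.natDegree_interiorPoly] at this
      rw [h1, h2]
      push_cast
      ring
    · rw [coeff_eq_zero_of_natDegree_lt (p := W) (by omega),
        coeff_eq_zero_of_natDegree_lt (p := r.interiorPoly)
          (by rw [r.natDegree_interiorPoly]; exact hl)]
      ring
  by_contra hne
  have hR0 : R ≠ 0 := sub_ne_zero.2 hne
  have hRn : R.natDegree < m := (natDegree_lt_iff_degree_lt hR0).2 hRd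
  have h1 : refAverage ((X ^ 2 - 1) * r.interiorPoly * R) = 0 := h.refAverage_nodePoly_mul hRd
  -- Integration by parts: (X² - 1)R vanishes at ±1 and its derivative has degree at most m.
  have h2 : refAverage (derivative (derivative W) * ((X ^ 2 - 1) * R)) = 0 := by
    rw [refAverage_derivative_mul, hW, h.refAverage_derivative_nodePoly_mul]
    · simp
    · refine (natDegree_derivative_le _).trans ?_
      have := natDegree_mul_le (p := (X ^ 2 - 1 : ℝ[X])) (q := R)
      rw [natDegree_X_sq_sub_one] at this
      omega
  have h3 : refAverage ((1 - X ^ 2) * R ^ 2) = 0 := by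
    have : (1 - X ^ 2) * R ^ 2 = C (((m : ℝ) + 2) * (m + 1)) * ((X ^ 2 - 1) * r.interiorPoly * R)
        + C (-1) * (derivative (derivative W) * ((X ^ 2 - 1) * R)) := by
      rw [C_neg, C_1]
      nth_rw 1 [sq, sq]
      nth_rw 1 [hR]
      ring
    rw [this, refAverage_add, refAverage_C_mul, refAverage_C_mul, h1, h2]
    ring
  refine (refAverage_pos (q := (1 - X ^ 2) * R ^ 2) (mul_ne_zero ?_ (pow_ne_zero 2 hR0)) ?_).ne'
    h3
  · rw [← neg_sub]
    exact neg_ne_zero.2 monic_X_sq_sub_one.ne_zero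
  · intro t ht
    simp only [eval_mul, eval_sub, eval_one, eval_pow, eval_X]
    have : 0 ≤ 1 - t ^ 2 := by nlinarith [ht.1, ht.2]
    positivity

/-- The polynomial (1 + sX)P, with P the interior node polynomial, vanishes at every other node and
equals 2P(s) at s. To average it, P is replaced by W''/((m+2)(m+1)) and one integrates by parts;
only the boundary term sW'(s) = 2P(s) survives. -/
theorem QuadRule.IsGaussLobatto.endpoint_weight (h : r.IsGaussLobatto) {s : ℝ} (hs : s ^ 2 = 1)
    {i : Fin (m + 2)} (hi : r.node i = s)
    (hother : ∀ j ≠ i, ((1 + C s * X) * r.interiorPoly).eval (r.node j) = 0)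
    (hne : r.interiorPoly.eval s ≠ 0) : r.weight i = omegaHat (m + 2) := by
  have hdeg : ((1 + C s * X) * r.interiorPoly).degree < ((2 * (m + 2) - 2 : ℕ) : WithBot ℕ) := by
    refine degree_lt_of_natDegree_lt ?_
    have h1 := natDegree_mul_le (p := 1 + C s * X) (q := r.interiorPoly)
    have h2 : (1 + C s * X).natDegree ≤ 1 := by compute_degree
    rw [r.natDegree_interiorPoly] at h1
    omega
  have h1 := h.exact.weight_mul_eq hdeg i hother
  set W := (X ^ 2 - 1) * r.interiorPoly with hW
  have h2 : ((m : ℝ) + 2) * (m + 1) * refAverage ((1 + C s * X) * r.interiorPoly) =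
      2 * r.interiorPoly.eval s := by
    have h4 : C (((m : ℝ) + 2) * (m + 1)) * ((1 + C s * X) * r.interiorPoly) =
        derivative (derivative W) * (1 + C s * X) := by
      rw [h.derivative_derivative_nodePoly]
      ring
    have h5 : refAverage (derivative W * derivative (1 + C s * X)) = 0 := by
      refine h.refAverage_derivative_nodePoly_mul ?_
      have : derivative (1 + C s * X) = C s := by simp
      rw [this, natDegree_C]
      omega
    rw [← refAverage_C_mul, h4, refAverage_derivative_mul, h5, hW]
    have h6 : s = 1 ∨ s = -1 := by simpa using hs
    rcases h6 with rfl | rfl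
    · simp [derivative_mul]; ring
    · simp [derivative_mul]; ring
  rw [← h1, hi] at h2
  have h3 : ((1 + C s * X) * r.interiorPoly).eval s = 2 * r.interiorPoly.eval s := by
    simp only [eval_mul, eval_add, eval_one, eval_C, eval_X]
    rw [← sq, hs]
    ring
  rw [h3] at h2
  have h7 : ((m : ℝ) + 2) * (m + 1) * r.weight i = 1 := by
    refine mul_right_cancel₀ (mul_ne_zero two_ne_zero hne) ?_
    linarith
  unfold omegaHat
  push_cast
  have h8 : (m : ℝ) + 2 - 1 = m + 1 := by ring
  rw [h8, eq_div_iff (by positivity)]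
  linarith

theorem QuadRule.IsGaussLobatto.eval_interiorPoly_ne_zero (h : r.IsGaussLobatto) {s : ℝ}
    (hs : s ^ 2 = 1) : r.interiorPoly.eval s ≠ 0 := by
  unfold QuadRule.interiorPoly
  rw [eval_prod]
  refine Finset.prod_ne_zero_iff.2 fun i _ => ?_
  have := h.node_interior i
  simp only [eval_sub, eval_X, eval_C]
  intro h0
  nlinarith

theorem QuadRule.IsGaussLobatto.weight_zero (h : r.IsGaussLobatto) :
    r.weight 0 = omegaHat (m + 2) := by
  refine h.endpoint_weight (s := -1) (by norm_num) h.node_zero (fun j hj => ?_)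
    (h.eval_interiorPoly_ne_zero (by norm_num))
  induction j using QuadRule.index_cases with
  | first => exact absurd rfl hj
  | last => simp [h.node_last]
  | interior i => simp [r.eval_interiorPoly_node]

theorem QuadRule.IsGaussLobatto.weight_last (h : r.IsGaussLobatto) :
    r.weight (Fin.last (m + 1)) = omegaHat (m + 2) := by
  refine h.endpoint_weight (s := 1) (by norm_num) h.node_last (fun j hj => ?_)
    (h.eval_interiorPoly_ne_zero (by norm_num))
  induction j using QuadRule.index_cases with
  | first => simp [h.node_zero]
  | last => exact absurd rfl hj
  | interior i => simp [r.eval_interiorPoly_node]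

/-- As for Gauss, but the factor 1 - X² removes the endpoints without spoiling the sign; the degree
is 2m. -/
theorem QuadRule.IsGaussLobatto.weight_interior_pos (h : r.IsGaussLobatto) (i : Fin m) :
    0 < r.weight i.castSucc.succ := by
  set p : ℝ[X] := ∏ j ∈ Finset.univ.erase i, (X - C (r.node j.castSucc.succ)) with hp
  have hmonic : p.Monic := monic_prod_of_monic _ _ fun j _ => monic_X_sub_C _
  have hdeg : p.natDegree = m - 1 := by
    rw [hp, natDegree_finsetProd_X_sub_C_eq_card]
    simp
  have hm : 0 < m := i.pos
  have hnonneg : ∀ t ∈ Set.Icc (-1 : ℝ) 1, 0 ≤ ((1 - X ^ 2) * p ^ 2).eval t := by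
    intro t ht
    simp only [eval_mul, eval_sub, eval_one, eval_pow, eval_X]
    have : 0 ≤ 1 - t ^ 2 := by nlinarith [ht.1, ht.2]
    positivity
  have hnode := h.node_interior i
  refine h.exact.weight_pos (q := (1 - X ^ 2) * p ^ 2) (degree_lt_of_natDegree_lt ?_) _ ?_
    (mul_ne_zero ?_ (hmonic.pow 2).ne_zero) (hnonneg _ ⟨hnode.1.le, hnode.2.le⟩) hnonneg
  · have h1 := natDegree_mul_le (p := (1 - X ^ 2 : ℝ[X])) (q := p ^ 2)
    have h2 : (1 - X ^ 2 : ℝ[X]).natDegree ≤ 2 := by compute_degree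
    rw [natDegree_pow, hdeg] at h1
    omega
  · refine QuadRule.index_cases (fun _ => ?_) (fun _ => ?_) (fun j hj => ?_)
    · simp [h.node_zero]
    · simp [h.node_last]
    · have hji : j ≠ i := fun e => hj (by rw [e])
      have : p.eval (r.node j.castSucc.succ) = 0 := by
        rw [hp, eval_prod]
        exact Finset.prod_eq_zero (Finset.mem_erase.2 ⟨hji, Finset.mem_univ j⟩) (by simp)
      simp [this]
  · rw [← neg_sub]
    exact neg_ne_zero.2 monic_X_sq_sub_one.ne_zero

end Lobatto

/-! ## Quadrature on the cells -/

theorem cellSize_pos {x : ℤ → ℝ} (hx : StrictMono x) (j : ℤ) : 0 < cellSize x j :=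
  sub_pos.2 (hx (by omega))

theorem cellPoint_neg_one (x : ℤ → ℝ) (j : ℤ) : cellPoint x j (-1) = x j := by
  unfold cellPoint cellSize; ring

theorem cellPoint_one (x : ℤ → ℝ) (j : ℤ) : cellPoint x j 1 = x (j + 1) := by
  unfold cellPoint cellSize; ring

theorem QuadRule.ExactBelow.sum_cellPoint {n d : ℕ} {r : QuadRule n} (h : r.ExactBelow d)
    {x : ℤ → ℝ} (hx : StrictMono x) (j : ℤ) {p : ℝ[X]} (hp : p.degree < d) :
    ∑ i, r.weight i * p.eval (cellPoint x j (r.node i)) =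
      (1 / cellSize x j) * ∫ y in (x j)..(x (j + 1)), p.eval y := by
  have hh := cellSize_pos hx j
  set q : ℝ[X] := p.comp (C ((x j + x (j + 1)) / 2) + C (cellSize x j / 2) * X) with hq
  have hev : ∀ t, q.eval t = p.eval (cellPoint x j t) := fun t => by
    simp [hq, eval_comp, cellPoint]
  have hqd : q.degree < d := by
    rcases eq_or_ne p 0 with rfl | hp0
    · simp [hq, bot_lt_iff_ne_bot]
    refine degree_lt_of_natDegree_lt ((natDegree_comp_le).trans_lt ?_)
    have h1 : p.natDegree < d := (natDegree_lt_iff_degree_lt hp0).2 hp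
    have h2 : (C ((x j + x (j + 1)) / 2) + C (cellSize x j / 2) * X).natDegree ≤ 1 := by
      compute_degree
    calc _ ≤ p.natDegree * 1 := Nat.mul_le_mul_left _ h2
      _ < d := by omega
  have h1 := h q hqd
  simp only [hev] at h1
  rw [h1]
  unfold cellPoint
  rw [intervalIntegral.integral_comp_add_mul (fun y => p.eval y) (by positivity)]
  have e1 : (x j + x (j + 1)) / 2 + cellSize x j / 2 * (-1) = x j := cellPoint_neg_one x j
  have e2 : (x j + x (j + 1)) / 2 + cellSize x j / 2 * 1 = x (j + 1) := cellPoint_one x j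
  rw [e1, e2, smul_eq_mul]
  field_simp

theorem integral_derivative (p : ℝ[X]) (a b : ℝ) :
    ∫ y in a..b, (derivative p).eval y = p.eval b - p.eval a :=
  intervalIntegral.integral_eq_sub_of_hasDerivAt (fun t _ => p.hasDerivAt t)
    (intervalIntegrable_eval _ _ _)

theorem QuadRule.ExactBelow.stateAverage_eq {n d k : ℕ} {r : QuadRule n} (h : r.ExactBelow d)
    (hk : k < d) {x : ℤ → ℝ} (hx : StrictMono x) {J : Set ℤ} {U : PiecewiseState}
    (hU : InVh3 J k U) {j : ℤ} (hj : j ∈ J) :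
    stateAverage x U j = ∑ i, r.weight i • valueAt U j (cellPoint x j (r.node i)) := by
  funext l
  rw [Finset.sum_apply]
  exact (h.sum_cellPoint hx j ((hU l j hj).trans_lt (by exact_mod_cast hk))).symm

/-! ## Interface fluxes -/

/-- Wave speeds are invariant under scaling of the state, so the pressure ratio enters only through
the factor c in the bound on A. -/
theorem smul_sub_scaled_hllc_mem_G {γ : ℝ} (hγ : 1 < γ) {V W : State} (hV : V ∈ G) (hW : W ∈ G)
    {c d a A : ℝ} (hc : 0 < c) (hd : 0 < d) (haV : alphaMax γ V ≤ a) (haW : alphaMax γ W ≤ a)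
    (hA : 2 * c * a ≤ A) : A • V - hllc γ (c • V) (d • W) ∈ G := by
  have h := smul_sub_hllc_mem_G hγ (smul_mem_G hV hc) (smul_mem_G hW hd) (a := a)
    (by rwa [alphaMax_smul γ hc hV]) (by rwa [alphaMax_smul γ hd hW])
  convert add_mem_G h (smul_mem_closedCone (mem_closedCone_of_mem_G hV) (sub_nonneg.2 hA)) using 1
  module

theorem smul_add_scaled_hllc_mem_G {γ : ℝ} (hγ : 1 < γ) {V W : State} (hV : V ∈ G) (hW : W ∈ G)
    {c d a A : ℝ} (hc : 0 < c) (hd : 0 < d) (haV : alphaMax γ V ≤ a) (haW : alphaMax γ W ≤ a)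
    (hA : 2 * d * a ≤ A) : A • W + hllc γ (c • V) (d • W) ∈ G := by
  have h := smul_add_hllc_mem_G hγ (smul_mem_G hV hc) (smul_mem_G hW hd) (a := a)
    (by rwa [alphaMax_smul γ hc hV]) (by rwa [alphaMax_smul γ hd hW])
  convert add_mem_G h (smul_mem_closedCone (mem_closedCone_of_mem_G hW) (sub_nonneg.2 hA)) using 1
  module

/-- The largest wave speed of the four traces at the two interfaces of the cell `j`. -/
noncomputable def maxTraceSpeed (γ : ℝ) (x : ℤ → ℝ) (U : PiecewiseState) (j : ℤ) : ℝ :=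
  max (max (alphaMax γ (valueAt U (j - 1) (x j))) (alphaMax γ (valueAt U j (x j))))
    (max (alphaMax γ (valueAt U j (x (j + 1)))) (alphaMax γ (valueAt U (j + 1) (x (j + 1)))))

section Interfaces

variable {γ : ℝ} {x : ℤ → ℝ} {pe : PiecewisePoly} {U : PiecewiseState} {j : ℤ}

theorem pStar_pos (h1 : 0 < (pe (j - 1)).eval (x j)) (h2 : 0 < (pe j).eval (x j)) :
    0 < pStar x pe j := by
  unfold pStar; linarith

theorem alphaF_smul_sub_modifiedFlux_mem_G (hγ : 1 < γ)
    (hp1 : 0 < (pe j).eval (x (j + 1))) (hp2 : 0 < (pe (j + 1)).eval (x (j + 1)))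
    (hU1 : valueAt U j (x (j + 1)) ∈ G) (hU2 : valueAt U (j + 1) (x (j + 1)) ∈ G) :
    alphaF γ x pe U j • valueAt U j (x (j + 1)) - modifiedFlux γ x pe U (j + 1) ∈ G := by
  have hj : j + 1 - 1 = j := by ring
  have hs : 0 < pStar x pe (j + 1) := pStar_pos (by rwa [hj]) hp2
  unfold modifiedFlux
  rw [hj]
  refine smul_sub_scaled_hllc_mem_G (a := maxTraceSpeed γ x U j) hγ hU1 hU2
    (div_pos hs hp1) (div_pos hs hp2)
    ((le_max_left _ _).trans (le_max_right _ _)) ((le_max_right _ _).trans (le_max_right _ _)) ?_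
  unfold alphaF
  refine mul_le_mul_of_nonneg_right (mul_le_mul_of_nonneg_left (le_max_left _ _) zero_le_two) ?_
  exact (alphaMax_pos hγ hU1).le.trans ((le_max_left _ _).trans (le_max_right _ _))

theorem alphaF_smul_add_modifiedFlux_mem_G (hγ : 1 < γ)
    (hp1 : 0 < (pe (j - 1)).eval (x j)) (hp2 : 0 < (pe j).eval (x j))
    (hU1 : valueAt U (j - 1) (x j) ∈ G) (hU2 : valueAt U j (x j) ∈ G) :
    alphaF γ x pe U j • valueAt U j (x j) + modifiedFlux γ x pe U j ∈ G := by
  have hs : 0 < pStar x pe j := pStar_pos hp1 hp2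
  unfold modifiedFlux
  refine smul_add_scaled_hllc_mem_G (a := maxTraceSpeed γ x U j) hγ hU1 hU2
    (div_pos hs hp1) (div_pos hs hp2)
    ((le_max_left _ _).trans (le_max_left _ _)) ((le_max_right _ _).trans (le_max_left _ _)) ?_
  unfold alphaF
  refine mul_le_mul_of_nonneg_right (mul_le_mul_of_nonneg_left (le_max_right _ _) zero_le_two) ?_
  exact (alphaMax_pos hγ hU2).le.trans ((le_max_right _ _).trans (le_max_left _ _))

theorem alphaF_nonneg (hγ : 1 < γ) (hp1 : 0 < (pe (j - 1)).eval (x j))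
    (hp2 : 0 < (pe j).eval (x j)) (hU : valueAt U j (x j) ∈ G) : 0 ≤ alphaF γ x pe U j := by
  have hs : 0 < pStar x pe j := pStar_pos hp1 hp2
  unfold alphaF
  refine mul_nonneg (mul_nonneg zero_le_two ?_) ?_
  · exact (div_pos hs hp2).le.trans (le_max_right _ _)
  · exact (alphaMax_pos hγ hU).le.trans ((le_max_right _ _).trans (le_max_left _ _))

end Interfaces

/-! ## Contributions to the updated cell average -/

theorem omegaHat_pos (m : ℕ) : 0 < omegaHat (m + 2) := by
  unfold omegaHat
  push_cast
  have h8 : (m : ℝ) + 2 - 1 = m + 1 := by ring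
  rw [h8]
  positivity

/-- The convective part of the update of a cell average is admissible. -/
theorem flux_update_mem_G {m : ℕ} {r : QuadRule (m + 2)} (hr : r.IsGaussLobatto)
    (V : Fin (m + 2) → State) (hV : ∀ i, V i ∈ G) {A l θ : ℝ} {Fl Fr : State} (hl : 0 < l)
    (hθ : 0 ≤ θ) (hA : θ * omegaHat (m + 2) = l * A)
    (hFl : A • V 0 + Fl ∈ G) (hFr : A • V (Fin.last (m + 1)) - Fr ∈ G) :
    θ • (∑ i, r.weight i • V i) - l • (Fr - Fl) ∈ G := by
  have hint : (∑ i : Fin m, r.weight i.castSucc.succ • V i.castSucc.succ) ∈ closedCone :=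
    sum_mem_closedCone _ _ fun i _ => smul_mem_closedCone (mem_closedCone_of_mem_G (hV _))
      (hr.weight_interior_pos i).le
  -- By `hA` the endpoint terms of the quadrature are exactly l·A times the two traces.
  convert add_mem_G (smul_mem_G hFl hl)
    (add_mem_closedCone (mem_closedCone_of_mem_G (smul_mem_G hFr hl))
      (smul_mem_closedCone hint hθ)) using 1
  rw [Fin.sum_univ_succ, Fin.sum_univ_castSucc, Fin.succ_last, hr.weight_zero, hr.weight_last,
    smul_add θ, smul_add θ, smul_smul θ, smul_smul θ, hA]
  module

/-- The quadrature part of the source term is admissible. -/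
theorem source_update_mem_closedCone {n : ℕ} (w : Fin n → ℝ) (hw : ∀ i, 0 ≤ w i)
    (V : Fin n → State) (hV : ∀ i, V i ∈ G) (a : Fin n → ℝ) {θ τ : ℝ}
    (ha : ∀ i, |τ * a i| ≤ θ * Real.sqrt (2 * internalEnergy (V i))) :
    θ • (∑ i, w i • V i) + τ • (∑ i, w i • a i • ![0, V i 0, V i 1]) ∈ closedCone := by
  have : θ • (∑ i, w i • V i) + τ • (∑ i, w i • a i • ![0, V i 0, V i 1]) =
      ∑ i, w i • (θ • V i + (τ * a i) • ![0, V i 0, V i 1]) := by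
    rw [Finset.smul_sum, Finset.smul_sum, ← Finset.sum_add_distrib]
    refine Finset.sum_congr rfl fun i _ => ?_
    module
  rw [this]
  exact sum_mem_closedCone _ _ fun i _ =>
    smul_mem_closedCone (add_source_mem_closedCone (hV i) (ha i)) (hw i)

/-! ## The scheme for the cell averages -/

section Scheme

variable {γ : ℝ} {k N : ℕ} {gauss : QuadRule N} {x : ℤ → ℝ} {J : Set ℤ} {ρe pe : PiecewisePoly}
  {U : PiecewiseState} {j : ℤ}

/-- Gauss quadrature is exact for the derivative of the equilibrium pressure and returns its
difference across the cell. Subtracted from the difference of the interface means, this leaves half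
the sum of the two jumps. -/
theorem sourceForm_one (hgauss : gauss.IsGauss) (hN : k + 1 ≤ 2 * N) (hx : StrictMono x)
    (hpe : (pe j).degree ≤ k) (q : PiecewisePoly) :
    sourceForm gauss x ρe pe q j 1 =
      cellSize x j * ∑ μ, gauss.weight μ *
        ((derivative (pe j)).eval (cellPoint x j (gauss.node μ)) /
            (ρe j).eval (cellPoint x j (gauss.node μ)) *
          (q j).eval (cellPoint x j (gauss.node μ)))
      + (jump x pe (j + 1) + jump x pe j) / (2 * cellAverage x ρe j) * cellAverage x q j := by
  have hh := cellSize_pos hx j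
  have hd : (derivative (pe j)).degree < ((2 * N : ℕ) : WithBot ℕ) :=
    (degree_derivative_le.trans hpe).trans_lt (by exact_mod_cast hN)
  have h1 := hgauss.exact.sum_cellPoint hx j hd
  rw [integral_derivative, one_div, eq_inv_mul_iff_mul_eq₀ hh.ne'] at h1
  unfold sourceForm
  simp only [eval_one, derivative_one, eval_zero, mul_zero, Finset.sum_const_zero, mul_one,
    sub_zero]
  have h2 : ∑ μ, gauss.weight μ * (((q j).eval (cellPoint x j (gauss.node μ)) /
          (ρe j).eval (cellPoint x j (gauss.node μ)) - cellAverage x q j / cellAverage x ρe j) *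
        (derivative (pe j)).eval (cellPoint x j (gauss.node μ))) =
      ∑ μ, gauss.weight μ * ((derivative (pe j)).eval (cellPoint x j (gauss.node μ)) /
            (ρe j).eval (cellPoint x j (gauss.node μ)) *
          (q j).eval (cellPoint x j (gauss.node μ))) -
      cellAverage x q j / cellAverage x ρe j *
        ∑ μ, gauss.weight μ * (derivative (pe j)).eval (cellPoint x j (gauss.node μ)) := by
    rw [Finset.mul_sum, ← Finset.sum_sub_distrib]
    refine Finset.sum_congr rfl fun μ _ => ?_
    ring
  have hj : j + 1 - 1 = j := by ring
  rw [h2, mul_sub, mul_left_comm (cellSize x j), h1]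
  unfold pStar jump
  rw [hj]
  ring

theorem sourceVector_one (hgauss : gauss.IsGauss) (hN : k + 1 ≤ 2 * N) (hx : StrictMono x)
    (hpe : (pe j).degree ≤ k) :
    sourceVector gauss x ρe pe U j 1 =
      cellSize x j • (∑ μ, gauss.weight μ •
        ((derivative (pe j)).eval (cellPoint x j (gauss.node μ)) /
            (ρe j).eval (cellPoint x j (gauss.node μ))) •
          ![0, valueAt U j (cellPoint x j (gauss.node μ)) 0,
            valueAt U j (cellPoint x j (gauss.node μ)) 1])
      + ((jump x pe (j + 1) + jump x pe j) / (2 * cellAverage x ρe j)) •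
        ![0, stateAverage x U j 0, stateAverage x U j 1] := by
  unfold sourceVector
  rw [sourceForm_one hgauss hN hx hpe, sourceForm_one hgauss hN hx hpe]
  funext i
  fin_cases i <;> simp [Finset.sum_apply, valueAt, stateAverage]

theorem average_update_mem_G (hγ : 1 < γ) {m : ℕ} (hN : k + 1 ≤ 2 * N)
    (hL : k + 3 ≤ 2 * (m + 2)) (hgauss : gauss.IsGauss) {lobatto : QuadRule (m + 2)}
    (hlobatto : lobatto.IsGaussLobatto) (hx : StrictMono x)
    (hρe : InVh J k ρe) (hpe : InVh J k pe) (hU : InVh3 J k U) (hj : j ∈ J)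
    (hePos : ∀ y ∈ pointSet gauss lobatto x j, 0 < (ρe j).eval y ∧ 0 < (pe j).eval y)
    (hUG : ∀ y ∈ pointSet gauss lobatto x j, valueAt U j y ∈ G)
    (hleft : 0 < (pe (j - 1)).eval (x j) ∧ valueAt U (j - 1) (x j) ∈ G)
    (hright : 0 < (pe (j + 1)).eval (x (j + 1)) ∧ valueAt U (j + 1) (x (j + 1)) ∈ G)
    {Δt : ℝ} (hΔt : 0 < Δt)
    (hCFL : alphaTilde (m + 2) γ gauss x ρe pe U j * Δt ≤ omegaHat (m + 2) * cellSize x j) :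
    stateAverage x U j + Δt • averageOperator γ gauss x ρe pe U j ∈ G := by
  have hh := cellSize_pos hx j
  have hω := omegaHat_pos m
  have hN0 : 0 < N := by omega
  have : Nonempty (Fin N) := ⟨⟨0, hN0⟩⟩
  have hlob : ∀ ν, cellPoint x j (lobatto.node ν) ∈ pointSet gauss lobatto x j :=
    fun ν => Or.inl ⟨ν, rfl⟩
  have hgau : ∀ μ, cellPoint x j (gauss.node μ) ∈ pointSet gauss lobatto x j :=
    fun μ => Or.inr ⟨μ, rfl⟩
  have hx0 : cellPoint x j (lobatto.node 0) = x j := by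
    rw [hlobatto.node_zero, cellPoint_neg_one]
  have hx1 : cellPoint x j (lobatto.node (Fin.last (m + 1))) = x (j + 1) := by
    rw [hlobatto.node_last, cellPoint_one]
  have hV0 : valueAt U j (x j) ∈ G := hx0 ▸ hUG _ (hlob 0)
  have hV1 : valueAt U j (x (j + 1)) ∈ G := hx1 ▸ hUG _ (hlob (Fin.last (m + 1)))
  have hp0 : 0 < (pe j).eval (x j) := hx0 ▸ (hePos _ (hlob 0)).2
  have hp1 : 0 < (pe j).eval (x (j + 1)) := hx1 ▸ (hePos _ (hlob (Fin.last (m + 1)))).2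
  have hgaussAvg := hgauss.exact.stateAverage_eq (k := k) (by omega) hx hU hj
  have hlobAvg := hlobatto.exact.stateAverage_eq (k := k) (by omega) hx hU hj
  have hAvgG : stateAverage x U j ∈ G := by
    rw [hgaussAvg]
    exact sum_mem_G _ fun μ => smul_mem_G (hUG _ (hgau μ)) (hgauss.weight_pos μ)
  have hρAvg : 0 < cellAverage x ρe j := by
    have h := hgauss.exact.sum_cellPoint hx j (p := ρe j)
      ((hρe j hj).trans_lt (by exact_mod_cast hN))
    unfold cellAverage
    rw [← h]
    exact Finset.sum_pos (fun μ _ => mul_pos (hgauss.weight_pos μ) (hePos _ (hgau μ)).1)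
      Finset.univ_nonempty
  have hAF := alphaF_nonneg (U := U) hγ hleft.1 hp0 hV0
  set e := omegaHat (m + 2) * cellSize x j with he
  have he0 : 0 < e := mul_pos hω hh
  -- The shares of the old average reserved for the flux, the nodal source and the jump source.
  set θF := alphaF γ x pe U j * Δt / e with hθF
  set θS := alphaS (m + 2) gauss x ρe pe U j * Δt / e with hθS
  set θB := alphaSBar (m + 2) x ρe pe U j * Δt / e with hθB
  have hθ : θF + θS + θB ≤ 1 := by
    rw [hθF, hθS, hθB, ← add_div, ← add_div, ← add_mul, ← add_mul]
    exact (div_le_one he0).2 hCFL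
  have hflux := flux_update_mem_G hlobatto
    (fun i => valueAt U j (cellPoint x j (lobatto.node i))) (fun i => hUG _ (hlob i))
    (A := alphaF γ x pe U j) (l := Δt / cellSize x j) (θ := θF)
    (Fl := modifiedFlux γ x pe U j) (Fr := modifiedFlux γ x pe U (j + 1))
    (by positivity) (by positivity) (by rw [hθF, he]; field_simp)
    (by rw [hx0]; exact alphaF_smul_add_modifiedFlux_mem_G hγ hleft.1 hp0 hleft.2 hV0)
    (by rw [hx1]; exact alphaF_smul_sub_modifiedFlux_mem_G hγ hp1 hright.1 hV1 hright.2)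
  have hsource := source_update_mem_closedCone gauss.weight (fun i => (hgauss.weight_pos i).le)
    (fun i => valueAt U j (cellPoint x j (gauss.node i))) (fun i => hUG _ (hgau i))
    (fun i => (derivative (pe j)).eval (cellPoint x j (gauss.node i)) /
      (ρe j).eval (cellPoint x j (gauss.node i))) (θ := θS) (τ := Δt) (by
      intro i
      have hρ := (hePos _ (hgau i)).1
      have hs : 0 < Real.sqrt
          (2 * internalEnergy (valueAt U j (cellPoint x j (gauss.node i)))) :=
        Real.sqrt_pos.2 (mul_pos two_pos (internalEnergy_pos (hUG _ (hgau i))))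
      have hsup := le_ciSup (Set.finite_range fun μ : Fin N =>
        |(derivative (pe j)).eval (cellPoint x j (gauss.node μ))| /
        ((ρe j).eval (cellPoint x j (gauss.node μ)) *
          Real.sqrt (2 * internalEnergy (valueAt U j (cellPoint x j (gauss.node μ)))))).bddAbove i
      have hθS' : θS = Δt * ⨆ μ : Fin N,
          |(derivative (pe j)).eval (cellPoint x j (gauss.node μ))| /
          ((ρe j).eval (cellPoint x j (gauss.node μ)) *
            Real.sqrt (2 * internalEnergy (valueAt U j (cellPoint x j (gauss.node μ))))) := by
        rw [hθS, alphaS, ← he, mul_assoc, mul_div_cancel_left₀ _ he0.ne', mul_comm]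
      rw [hθS', mul_assoc, abs_mul, abs_of_pos hΔt, abs_div, abs_of_pos hρ]
      refine mul_le_mul_of_nonneg_left ?_ hΔt.le
      rw [← div_le_iff₀ hs, div_div]
      exact hsup)
  have hbar := add_source_mem_closedCone hAvgG (s := θB)
    (a := Δt / cellSize x j *
      ((jump x pe (j + 1) + jump x pe j) / (2 * cellAverage x ρe j))) (by
      have hs : 0 < Real.sqrt (2 * internalEnergy (stateAverage x U j)) :=
        Real.sqrt_pos.2 (mul_pos two_pos (internalEnergy_pos hAvgG))
      rw [abs_mul, abs_div (jump x pe (j + 1) + jump x pe j),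
        abs_of_pos (div_pos hΔt hh), abs_of_pos (mul_pos two_pos hρAvg), hθB, alphaSBar, he]
      -- `alphaSBar` is defined so that the source bound holds with equality.
      refine le_of_eq ?_
      field_simp)
  have hrest := smul_mem_closedCone (mem_closedCone_of_mem_G hAvgG) (sub_nonneg.2 hθ)
  rw [← hlobAvg] at hflux
  rw [← hgaussAvg] at hsource
  -- Strict admissibility comes from the flux part; the other three terms need only lie in the
  -- closed cone.
  convert add_mem_G hflux (add_mem_closedCone hrest (add_mem_closedCone hsource hbar)) using 1
  unfold averageOperator
  rw [sourceVector_one hgauss hN hx (hpe j hj), smul_add (1 / cellSize x j), smul_smul,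
    one_div_mul_cancel hh.ne']
  module

theorem IsForwardEulerStep.stateAverage_eq {Δt : ℝ} {Unew : PiecewiseState}
    (h : IsForwardEulerStep J k γ gauss x ρe pe Δt U Unew) (hj : j ∈ J) :
    stateAverage x Unew j = stateAverage x U j + Δt • averageOperator γ gauss x ρe pe U j := by
  funext i
  have h1 := h.2 j hj 1 (by rw [degree_one]; exact_mod_cast Nat.zero_le k) i
  simp only [eval_one, mul_one] at h1
  have h2 : averageOperator γ gauss x ρe pe U j =
      (1 / cellSize x j) • weakRHS γ gauss x ρe pe U j 1 := by
    unfold averageOperator weakRHS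
    simp only [derivative_one, eval_zero, eval_one, mul_zero, zero_smul, Finset.sum_const_zero,
      smul_zero]
    module
  rw [h2]
  simp only [stateAverage, cellAverage, Pi.add_apply, Pi.smul_apply, smul_eq_mul]
  rw [h1]
  ring

end Scheme

/-- Both endpoints of a cell are Gauss–Lobatto points. -/
theorem pointSet_endpoints {N L : ℕ} {gauss : QuadRule N} {lobatto : QuadRule L}
    (h : lobatto.IsGaussLobatto) (x : ℤ → ℝ) (j : ℤ) :
    x j ∈ pointSet gauss lobatto x j ∧ x (j + 1) ∈ pointSet gauss lobatto x j := by
  have hL := h.two_le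
  refine ⟨Or.inl ⟨⟨0, by omega⟩, ?_⟩, Or.inl ⟨⟨L - 1, by omega⟩, ?_⟩⟩
  · simp only [h.first_node ⟨0, by omega⟩ rfl, cellPoint_neg_one]
  · simp only [h.last_node ⟨L - 1, by omega⟩ (by simp only; omega), cellPoint_one]

end WBDG

theorem mainTheorem1
    -- adiabatic index, polynomial degree, Gauss rule and Gauss–Lobatto rule
    (γ : ℝ) (hγ : 1 < γ) (k N L : ℕ) (hN : k + 1 ≤ 2 * N) (hL : k + 3 ≤ 2 * L)
    (gauss : WBDG.QuadRule N) (hgauss : gauss.IsGauss)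
    (lobatto : WBDG.QuadRule L) (hlobatto : lobatto.IsGaussLobatto)
    -- mesh and the set of the cells of the domain
    (x : ℤ → ℝ) (hx : StrictMono x) (J : Set ℤ)
    -- discrete equilibrium and numerical solution
    (ρe pe : WBDG.PiecewisePoly) (hρe : WBDG.InVh J k ρe) (hpe : WBDG.InVh J k pe)
    (U : WBDG.PiecewiseState) (hU : WBDG.InVh3 J k U)
    -- positivity of the equilibrium and admissibility of the solution at the points of each cell
    (hePos : ∀ j ∈ J, ∀ y ∈ WBDG.pointSet gauss lobatto x j,
      0 < (ρe j).eval y ∧ 0 < (pe j).eval y)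
    (hUG : ∀ j ∈ J, ∀ y ∈ WBDG.pointSet gauss lobatto x j, WBDG.valueAt U j y ∈ WBDG.G)
    -- the same for the exterior traces supplied by the boundary conditions, if there is a boundary
    (hleft : ∀ j ∈ J, j - 1 ∉ J →
      0 < (pe (j - 1)).eval (x j) ∧ WBDG.valueAt U (j - 1) (x j) ∈ WBDG.G)
    (hright : ∀ j ∈ J, j + 1 ∉ J →
      0 < (pe (j + 1)).eval (x (j + 1)) ∧ WBDG.valueAt U (j + 1) (x (j + 1)) ∈ WBDG.G)
    -- time step and CFL condition
    (Δt : ℝ) (hΔt : 0 < Δt)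
    (hCFL : ∀ j ∈ J, WBDG.alphaTilde L γ gauss x ρe pe U j * Δt
      ≤ WBDG.omegaHat L * WBDG.cellSize x j) :
    (∀ j ∈ J, WBDG.stateAverage x U j + Δt • WBDG.averageOperator γ gauss x ρe pe U j ∈ WBDG.G) ∧
      (∀ Unew : WBDG.PiecewiseState,
        WBDG.IsForwardEulerStep J k γ gauss x ρe pe Δt U Unew →
          ∀ j ∈ J, WBDG.stateAverage x Unew j ∈ WBDG.G) := by
  have hmain : ∀ j ∈ J,
      WBDG.stateAverage x U j + Δt • WBDG.averageOperator γ gauss x ρe pe U j ∈ WBDG.G := by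
    intro j hj
    obtain ⟨m, rfl⟩ : ∃ m, L = m + 2 := ⟨L - 2, by have := hlobatto.two_le; omega⟩
    refine WBDG.average_update_mem_G hγ hN hL hgauss hlobatto hx hρe hpe hU hj (hePos j hj)
      (hUG j hj) ?_ ?_ hΔt (hCFL j hj)
    · by_cases h : j - 1 ∈ J
      · have hp := (WBDG.pointSet_endpoints (gauss := gauss) hlobatto x (j - 1)).2
        rw [sub_add_cancel] at hp
        exact ⟨(hePos _ h _ hp).2, hUG _ h _ hp⟩
      · exact hleft j hj h
    · by_cases h : j + 1 ∈ J
      · have hp := (WBDG.pointSet_endpoints (gauss := gauss) hlobatto x (j + 1)).1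
        exact ⟨(hePos _ h _ hp).2, hUG _ h _ hp⟩
      · exact hright j hj h
  refine ⟨hmain, fun Unew hnew j hj => ?_⟩
  rw [hnew.stateAverage_eq hj]
  exact hmain j hj
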